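/- Let $p\ge 1$ and $X=\{0,1,\dots,p\}$. For $i\in\{1,\dots,p\}$ let $e_i$ be the permutation of the set $X^\infty$ of infinite words defined recursively by $e_i(0w)=i\,e_i(w)$, $e_i(iw)=0w$, and $e_i(jw)=jw$ for $j\ne 0,i$, and let $\mathcal G_{S_p}=\langle e_1,\dots,e_p\rangle$ be the star automaton group. For $v\in X^\infty$ let $\Gamma^p_v$ be the Schreier graph of the action of $\mathcal G_{S_p}$ on the orbit of $v$ with respect to the generators $e_i^{\pm1}$, let $E_k$ be the set of $v\in X^\infty$ such that $\Gamma^p_v$ has exactly $k$ ends, and let $Cof(w)$ be the set of infinite words that differ from $w$ in finitely many positions only. Let $\nu$ be the uniform (Bernoulli) probability measure on $X^\infty$. For every $v\in X^\infty$ the graph $\Gamma^p_v$ has $2p$, $2$ or $1$ ends. If moreover $p\ge 2$, then: 1. $E_{2p}=Cof(0^\infty)\cup Cof(1^\infty)\cup\dots\cup Cof(p^\infty)$, and $E_{2p}$ is a single orbit of $\mathcal G_{S_p}$. 2. $E_2=\Bigl(\bigcup_{i=1}^p\bigcup_{w\in\{0,i\}^\infty}Cof(w)\Bigr)\setminus E_{2p}$,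 and $E_2$ is the union of uncountably many orbits. 3. $E_1=X^\infty\setminus(E_{2p}\cup E_2)$, and $E_1$ is the union of uncountably many orbits. Moreover, for $p \ge 2$, the set $E_1$ is Borel and $\nu(E_1)=1$. -/

import Mathlib

open Set MeasureTheory

/-- An invertible automaton with set of states `S` over the alphabet `X`: a restriction map `S × X → S`
and an output map `S × X → X` whose section at every state is a permutation of `X`. -/
structure InvertibleAutomaton (S X : Type*) where
  restr : S → X → S
  out : S → Equiv.Perm X

namespace InvertibleAutomaton

variable {S X : Type*}

/-- The state in which `A`, started in the state `s`, reads the `n`-th letter of the infinite word `w`. -/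
def stateAt (A : InvertibleAutomaton S X) (s : S) (w : ℕ → X) : ℕ → S
  | 0 => s
  | n + 1 => A.restr (A.stateAt s w n) (w n)

/-- The transformation of infinite words defined by the state `s`. -/
def act (A : InvertibleAutomaton S X) (s : S) (w : ℕ → X) : ℕ → X :=
  fun n => A.out (A.stateAt s w n) (w n)

/-- The inverse automaton (input and output exchanged). -/
def inv (A : InvertibleAutomaton S X) : InvertibleAutomaton S X where
  restr s x := A.restr s ((A.out s).symm x)
  out s := (A.out s).symm

theorem inv_inv (A : InvertibleAutomaton S X) : A.inv.inv = A := by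
  cases A
  simp [inv]

theorem stateAt_inv_act (A : InvertibleAutomaton S X) (s : S) (w : ℕ → X) (n : ℕ) :
    A.inv.stateAt s (A.act s w) n = A.stateAt s w n := by
  induction n with
  | zero => rfl
  | succ n ih =>
    change A.inv.restr (A.inv.stateAt s (A.act s w) n) (A.act s w n) = _
    rw [ih]
    simp [inv, act, stateAt]

theorem inv_act_act (A : InvertibleAutomaton S X) (s : S) (w : ℕ → X) :
    A.inv.act s (A.act s w) = w := by
  funext n
  change A.inv.out (A.inv.stateAt s (A.act s w) n) (A.act s w n) = _
  rw [stateAt_inv_act]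
  simp [inv, act]

/-- The state `s` as a permutation of the set of infinite words (the boundary of the tree). -/
def perm (A : InvertibleAutomaton S X) (s : S) : Equiv.Perm (ℕ → X) where
  toFun := A.act s
  invFun := A.inv.act s
  left_inv := A.inv_act_act s
  right_inv w := by simpa only [A.inv_inv] using A.inv.inv_act_act s w

/-- The automaton group, acting (faithfully) on infinite words. -/
def group (A : InvertibleAutomaton S X) : Subgroup (Equiv.Perm (ℕ → X)) :=
  Subgroup.closure (Set.range A.perm)

/-- The orbit of an infinite word under the automaton group. -/
def orbit (A : InvertibleAutomaton S X) (w : ℕ → X) : Set (ℕ → X) :=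
  MulAction.orbit A.group w

/-- The Schreier graph on the orbit of `w`, with respect to the states and their inverses: distinct
`u` and `v` are adjacent if and only if a generator or its inverse sends `u` to `v`.  (Loops and multiplicities
of edges are forgotten; they do not affect ends.) -/
def schreierGraph (A : InvertibleAutomaton S X) (w : ℕ → X) : SimpleGraph (A.orbit w) :=
  SimpleGraph.fromRel fun u v => ∃ s : S, A.perm s (u : ℕ → X) = (v : ℕ → X)

/-- The set `O` of infinite words consists of uncountably many orbits. -/
def ConsistsOfUncountablyManyOrbits (A : InvertibleAutomaton S X) (O : Set (ℕ → X)) : Prop :=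
  ∃ 𝒪 : Set (Set (ℕ → X)), (∀ o ∈ 𝒪, ∃ w, o = A.orbit w) ∧ ¬ 𝒪.Countable ∧ O = ⋃₀ 𝒪

end InvertibleAutomaton

/-- The automaton of a graph with vertex set `V` whose edges `e : E` have been oriented from `src e` to
`tgt e`.  The states are the edges and a sink `none`; the edge `e` exchanges the letters `src e` and
`tgt e`, restricts to itself at `src e` and to the sink at every other letter. -/
def graphAutomaton {V E : Type*} [DecidableEq V] (src tgt : E → V) :
    InvertibleAutomaton (Option E) V where
  restr
    | none, _ => none
    | some e, x => if x = src e then some e else none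
  out
    | none => 1
    | some e => Equiv.swap (src e) (tgt e)

/-- The automaton of the star with centre `0` and leaves `1, …, p`, with edges `0 → i`. -/
def starAutomaton (p : ℕ) : InvertibleAutomaton (Option (Fin p)) (Fin (p + 1)) :=
  graphAutomaton (fun _ => 0) Fin.succ

/-- The set of infinite words whose star Schreier graph has exactly `k` ends. -/
def endedWords (p k : ℕ) : Set (ℕ → Fin (p + 1)) :=
  {w | ((starAutomaton p).schreierGraph w).end.encard = (k : ℕ∞)}

/-- The set of infinite words cofinal to `ξ`. -/
def cof {X : Type*} (ξ : ℕ → X) : Set (ℕ → X) :=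
  {η | ∃ k : ℕ, ∀ n, k ≤ n → ξ n = η n}

/-- The uniform measure on infinite words: the product of the uniform probability measures on letters. -/
noncomputable def uniformWordMeasure (p : ℕ) : Measure (ℕ → Fin (p + 1)) :=
  Measure.infinitePi fun _ : ℕ => (PMF.uniformOfFintype (Fin (p + 1))).toMeasure

/-!
# Ends of the Schreier graphs of the star automaton groups

The generator `e_c` exchanges `0` and the leaf `c` in every letter up to and including the first
nonzero one (`leafPerm_apply`).  Hence it changes the tail of a word only after a prefix of zeros, the
orbit of a word that is not eventually constant is its cofinality class (`orbit_eq_cof`), and the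
eventually constant words form a single orbit (`orbit_zero`), because `e_c (0 ^ ∞) = c ^ ∞`.  On the
words over `{0, c}` the generator `e_c` is the binary odometer, all of whose orbits are infinite lines
(`leafPerm_zpow_injective`); on all other words its orbits are finite cycles
(`exists_pow_leafPerm_eq_self`).  The Schreier graphs are trees of these cycles and lines.

The ends are counted with labels (`SimpleGraph.encard_end_eq_of_labelling`): if a labelling of the
vertices is constant along the edges outside a finite set, every label occurs infinitely often, and
outside arbitrarily large finite sets any two vertices with the same label are connected, then ends
correspond to labels.  As the graphs are connected, it suffices to connect the vertices next to the
removed set.  There are three cases.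

* If `w` is not eventually constant and `w n = j ≠ 0`, only two words lie next to the block of the words
  that agree with `w` from position `n` on, namely `e_j (0 ^ n w_n w_{n+1} …)` and
  `e_j⁻¹ (j ^ n w_n w_{n+1} …)` (`outerBoundary_block`).  If `w` is not eventually over `{0, j}`, both
  lie on a finite cycle of `e_j`, whose arc outside the block joins them.  So if `w` is not eventually
  over `{0, j}` for any `j`, a single label suffices and there is one end (`encard_end_eq_one`).
* If `w` is a word over `{0, j}` that is not eventually constant, the line `{e_j ^ t w}` lies in the
  graph, and erasing all letters up to the last one outside `{0, j}` retracts the graph onto that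
  line (`lineProj_leafPerm_of_ne`, `lineProj_leafPerm_self`).  The two words next to a block
  project to different sides of `w`, so there are two ends (`encard_end_eq_two`).
* For the orbit of `0 ^ ∞`, which lies on the `p` lines of the generators, the label of a word records
  the line it is attached to and the side of `0 ^ ∞` (`direction`).  Next to the finite set of the words
  that are constant from position `n` on there is one word for each of the `2 * p` labels
  (`outerBoundary_constantFrom`, `encard_end_eq_two_mul`).

Orbits are countable, so uncountably many of them are needed to cover an uncountable set; and a
word that is eventually over `{0, j}` avoids another letter from some position on, which has
probability `0` when `p ≥ 2`.
-/

/-! ### Counting the ends of a graph by labels -/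

namespace SimpleGraph

variable {V ι : Type*} (G : SimpleGraph V)

/-- Two ends of `G` that choose the same component outside arbitrarily large finite sets are equal. -/
theorem end_ext_of_cofinal {s t : (K : (Finset V)ᵒᵖ) → G.componentComplFunctor.obj K}
    (hs : s ∈ G.end) (ht : t ∈ G.end)
    (h : ∀ F : Finset V, ∃ K : Finset V, F ⊆ K ∧ s (.op K) = t (.op K)) : s = t := by
  funext F
  obtain ⟨K, hFK, hK⟩ := h F.unop
  have f : Opposite.op K ⟶ F := (CategoryTheory.homOfLE (show F.unop ≤ K from hFK)).op
  rw [← hs f, ← ht f, hK]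

/-- **Counting ends by labels.**  Suppose that the vertices of a graph are labelled so that every label
occurs infinitely often, that adjacent vertices outside a finite set `K₀` have the same label, and
that outside arbitrarily large finite sets vertices with the same label lie in the same component.
Then the ends of the graph correspond to the labels. -/
theorem encard_end_eq_of_labelling (ℓ : V → ι) {K₀ : Set V} (hK₀ : K₀.Finite)
    (hℓ : ∀ u v, u ∉ K₀ → v ∉ K₀ → G.Adj u v → ℓ u = ℓ v)
    (hinf : ∀ i, (ℓ ⁻¹' {i}).Infinite)
    (hconn : ∀ F : Set V, F.Finite → ∃ K : Set V, K.Finite ∧ F ⊆ K ∧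
      ∀ u v (hu : u ∉ K) (hv : v ∉ K), ℓ u = ℓ v →
        G.componentComplMk hu = G.componentComplMk hv) :
    G.end.encard = ENat.card ι := by
  classical
  lift K₀ to Finset V using hK₀
  -- Outside a finite set containing `K₀` the label depends on the component only.
  let lab : G.ComponentCompl (K₀ : Set V) → ι :=
    ComponentCompl.lift (fun v _ => ℓ v) fun v w hv hw h => hℓ v w hv hw h
  have hlarge : ∀ F : Finset V, ∃ K : Finset V, F ⊆ K ∧ K₀ ⊆ K ∧
      ∀ u v (hu : u ∉ (K : Set V)) (hv : v ∉ (K : Set V)), ℓ u = ℓ v →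
        G.componentComplMk hu = G.componentComplMk hv := by
    intro F
    obtain ⟨K, hKfin, hFK, hK⟩ := hconn ↑(F ∪ K₀) (F ∪ K₀).finite_toSet
    lift K to Finset V using hKfin
    have hFK' : F ∪ K₀ ⊆ K := by exact_mod_cast hFK
    exact ⟨K, Finset.union_subset_left hFK', Finset.union_subset_right hFK', hK⟩
  choose L hFL hK₀L hL using hlarge
  have hvert : ∀ (i : ι) (K : Finset V), ∃ v, ℓ v = i ∧ v ∉ (K : Set V) := by
    intro i K
    obtain ⟨v, hv, hvK⟩ := (hinf i).exists_notMem_finset K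
    exact ⟨v, hv, by simpa using hvK⟩
  choose vert hvert_lab hvert_notMem using hvert
  -- The end with label `i` points, outside `F`, to the vertices labelled `i` outside `L F`.
  have hmem : ∀ (i : ι) (F : Finset V), vert i (L F) ∉ (F : Set V) := fun i F hm =>
    hvert_notMem i (L F) (Finset.coe_subset.2 (hFL F) hm)
  have key : ∀ (i : ι) (F : Finset V) (v : V) (hv : v ∉ (L F : Set V)), ℓ v = i →
      G.componentComplMk (hmem i F) =
        G.componentComplMk (Set.notMem_subset (Finset.coe_subset.2 (hFL F)) hv) := by
    intro i F v hv hvi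
    have h := hL F _ v (hvert_notMem i (L F)) hv ((hvert_lab i (L F)).trans hvi.symm)
    exact congrArg (ComponentCompl.hom (Finset.coe_subset.2 (hFL F))) h
  let sec : ι → (K : (Finset V)ᵒᵖ) → G.componentComplFunctor.obj K :=
    fun i K => G.componentComplMk (hmem i K.unop)
  have hsec : ∀ i, sec i ∈ G.end := by
    intro i F F' f
    have hsub : F'.unop ⊆ F.unop := CategoryTheory.leOfHom f.unop
    have hv := hvert_notMem i (L F.unop ∪ L F'.unop)
    rw [Finset.coe_union, Set.mem_union, not_or] at hv
    have h1 := key i F.unop _ hv.1 (hvert_lab _ _)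
    have h2 := key i F'.unop _ hv.2 (hvert_lab _ _)
    change ComponentCompl.hom (Finset.coe_subset.2 hsub) (G.componentComplMk (hmem i F.unop)) =
      G.componentComplMk (hmem i F'.unop)
    rw [h1, h2]
    rfl
  have hlab_sec : ∀ i, lab (sec i (.op K₀)) = i := fun i => hvert_lab i (L K₀)
  have hbij : Function.Bijective fun e : G.end => lab (e.1 (.op K₀)) := by
    constructor
    · rintro ⟨s, hs⟩ ⟨t, ht⟩ hst
      refine Subtype.ext (G.end_ext_of_cofinal hs ht fun F => ⟨L F, hFL F, ?_⟩)
      obtain ⟨u, hu, hsu⟩ := ComponentCompl.exists_eq_mk (s (.op (L F)))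
      obtain ⟨v, hv, htv⟩ := ComponentCompl.exists_eq_mk (t (.op (L F)))
      have f : Opposite.op (L F) ⟶ Opposite.op K₀ := (CategoryTheory.homOfLE (hK₀L F)).op
      refine hsu.symm.trans (Eq.trans (hL F _ _ _ _ ?_) htv)
      have h1 := G.end_hom_mk_of_mk hs f hu hsu.symm
      have h2 := G.end_hom_mk_of_mk ht f hv htv.symm
      change lab (s (.op K₀)) = lab (t (.op K₀)) at hst
      rw [h1, h2] at hst
      exact hst
    · exact fun i => ⟨⟨sec i, hsec i⟩, hlab_sec i⟩
  rw [Set.encard]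
  exact ENat.card_congr (Equiv.ofBijective _ hbij)

/-- In a connected graph every component outside `K` touches `K`, so in the criterion for counting
ends only the vertices adjacent to `K` have to be joined. -/
theorem componentComplMk_eq_of_boundary (hG : G.Preconnected) (ℓ : V → ι) {K : Set V}
    (hne : K.Nonempty) (hℓ : ∀ u v, u ∉ K → v ∉ K → G.Adj u v → ℓ u = ℓ v)
    (hb : ∀ u v (hu : u ∉ K) (hv : v ∉ K), (∃ k ∈ K, G.Adj u k) → (∃ k ∈ K, G.Adj v k) →
      ℓ u = ℓ v → G.componentComplMk hu = G.componentComplMk hv)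
    {u v : V} (hu : u ∉ K) (hv : v ∉ K) (huv : ℓ u = ℓ v) :
    G.componentComplMk hu = G.componentComplMk hv := by
  let lab : G.ComponentCompl K → ι :=
    ComponentCompl.lift (fun v _ => ℓ v) fun v w hv hw h => hℓ v w hv hw h
  have aux : ∀ x (hx : x ∉ K), ∃ y, ∃ hy : y ∉ K, (∃ k ∈ K, G.Adj y k) ∧ ℓ y = ℓ x ∧
      G.componentComplMk hy = G.componentComplMk hx := by
    intro x hx
    obtain ⟨⟨y, k⟩, ⟨hyK, hy⟩, hk, hyk⟩ :=
      ComponentCompl.exists_adj_boundary_pair hG hne (G.componentComplMk hx)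
    exact ⟨y, hyK, ⟨k, hk, hyk⟩, congrArg lab hy, hy⟩
  obtain ⟨u', hu', hku, hlu, hcu⟩ := aux u hu
  obtain ⟨v', hv', hkv, hlv, hcv⟩ := aux v hv
  rw [← hcu, ← hcv]
  exact hb u' v' hu' hv' hku hkv (by rw [hlu, hlv, huv])

end SimpleGraph

/-! ### Schreier graphs of automata -/

namespace InvertibleAutomaton

variable {S X ι : Type*} (A : InvertibleAutomaton S X)

theorem mem_orbit_self (w : ℕ → X) : w ∈ A.orbit w := MulAction.mem_orbit_self w

theorem perm_mem_group (s : S) : A.perm s ∈ A.group := Subgroup.subset_closure ⟨s, rfl⟩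

theorem orbit_eq_of_mem {u w : ℕ → X} (h : u ∈ A.orbit w) : A.orbit u = A.orbit w :=
  MulAction.orbit_eq_iff.2 h

theorem mem_orbit_symm {u w : ℕ → X} (h : u ∈ A.orbit w) : w ∈ A.orbit u :=
  A.orbit_eq_of_mem h ▸ A.mem_orbit_self w

theorem mem_orbit_trans {u v w : ℕ → X} (huv : u ∈ A.orbit v) (hvw : v ∈ A.orbit w) :
    u ∈ A.orbit w := A.orbit_eq_of_mem hvw ▸ huv

theorem perm_mem_orbit (s : S) (w : ℕ → X) : A.perm s w ∈ A.orbit w :=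
  ⟨⟨A.perm s, A.perm_mem_group s⟩, rfl⟩

theorem perm_mem_orbit_iff {s : S} {u w : ℕ → X} : A.perm s u ∈ A.orbit w ↔ u ∈ A.orbit w :=
  ⟨fun h => A.mem_orbit_trans (A.mem_orbit_symm (A.perm_mem_orbit s u)) h,
    fun h => A.mem_orbit_trans (A.perm_mem_orbit s u) h⟩

/-- A set of words invariant under the generators contains the orbits of its elements. -/
theorem orbit_subset {T : Set (ℕ → X)} (hT : ∀ s u, A.perm s u ∈ T ↔ u ∈ T) {w : ℕ → X}
    (hw : w ∈ T) : A.orbit w ⊆ T := by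
  have h : ∀ g ∈ A.group, ∀ u, g u ∈ T ↔ u ∈ T := by
    intro g hg
    induction hg using Subgroup.closure_induction with
    | mem g hg =>
      obtain ⟨s, rfl⟩ := hg
      exact hT s
    | one => exact fun u => Iff.rfl
    | mul g g' _ _ ih ih' => exact fun u => (ih _).trans (ih' u)
    | inv g _ ih =>
      intro u
      exact (ih (g⁻¹ u)).symm.trans (by simp)
  rintro _ ⟨g, rfl⟩
  exact (h g g.2 w).2 hw

theorem schreierGraph_adj {w : ℕ → X} {u v : A.orbit w} : (A.schreierGraph w).Adj u v ↔
    u ≠ v ∧ ((∃ s, A.perm s u = (v : ℕ → X)) ∨ ∃ s, A.perm s v = (u : ℕ → X)) :=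
  SimpleGraph.fromRel_adj _ _ _

theorem schreierGraph_preconnected (w : ℕ → X) : (A.schreierGraph w).Preconnected := by
  let T : Set (ℕ → X) := {u | ∃ hu : u ∈ A.orbit w,
    (A.schreierGraph w).Reachable ⟨w, A.mem_orbit_self w⟩ ⟨u, hu⟩}
  have step : ∀ s u (hu : u ∈ A.orbit w), (A.schreierGraph w).Reachable ⟨u, hu⟩
      ⟨A.perm s u, A.perm_mem_orbit_iff.2 hu⟩ := by
    intro s u hu
    by_cases h : A.perm s u = u
    · simp only [h, SimpleGraph.Reachable.refl]
    · exact SimpleGraph.Adj.reachable <| A.schreierGraph_adj.2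
        ⟨fun h' => h (congrArg Subtype.val h').symm, Or.inl ⟨s, rfl⟩⟩
  have hT : A.orbit w ⊆ T := by
    refine A.orbit_subset (fun s u => ⟨?_, ?_⟩) ⟨A.mem_orbit_self w, SimpleGraph.Reachable.refl _⟩
    · rintro ⟨hu, h⟩
      exact ⟨A.perm_mem_orbit_iff.1 hu, h.trans (step s u _).symm⟩
    · rintro ⟨hu, h⟩
      exact ⟨A.perm_mem_orbit_iff.2 hu, h.trans (step s u hu)⟩
  rintro ⟨u, hu⟩ ⟨v, hv⟩
  exact (hT hu).2.symm.trans (hT hv).2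

/-- The words outside `K` that a generator or its inverse moves into `K`. -/
def outerBoundary (K : Set (ℕ → X)) : Set (ℕ → X) :=
  {u | u ∉ K ∧ ∃ s, A.perm s u ∈ K ∨ ∃ x ∈ K, A.perm s x = u}

/-- Two words can be joined by a path of the Schreier graph that avoids `K`. -/
def JoinedOutside (K : Set (ℕ → X)) : (ℕ → X) → (ℕ → X) → Prop :=
  Relation.EqvGen fun x y => x ∉ K ∧ y ∉ K ∧ ∃ s, A.perm s x = y

/-- The criterion for counting ends by labels, for a Schreier graph and in terms of words. -/
theorem encard_end_schreierGraph (w : ℕ → X) (ℓ : (ℕ → X) → ι) {K₀ : Set (ℕ → X)}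
    (hK₀ : K₀.Finite)
    (hℓ : ∀ s, ∀ u ∈ A.orbit w, u ∉ K₀ → A.perm s u ∉ K₀ → ℓ (A.perm s u) = ℓ u)
    (hinf : ∀ i, {u | u ∈ A.orbit w ∧ ℓ u = i}.Infinite)
    (hK : ∀ F : Set (ℕ → X), F.Finite → F ⊆ A.orbit w → ∃ K : Set (ℕ → X), K.Finite ∧ F ⊆ K ∧
      ∀ u ∈ A.orbit w ∩ A.outerBoundary K, ∀ v ∈ A.orbit w ∩ A.outerBoundary K, ℓ u = ℓ v →
        A.JoinedOutside K u v) :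
    (A.schreierGraph w).end.encard = ENat.card ι := by
  let c : A.orbit w → (ℕ → X) := Subtype.val
  have hc : Function.Injective c := Subtype.val_injective
  have hadj : ∀ u v : A.orbit w, c u ∉ K₀ → c v ∉ K₀ → (A.schreierGraph w).Adj u v →
      ℓ (c u) = ℓ (c v) := by
    intro u v hu hv huv
    obtain ⟨-, ⟨s, hs⟩ | ⟨s, hs⟩⟩ := A.schreierGraph_adj.1 huv
    · rw [show c v = A.perm s u from hs.symm]
      exact (hℓ s _ u.2 hu (by rw [hs]; exact hv)).symm
    · rw [show c u = A.perm s v from hs.symm]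
      exact hℓ s _ v.2 hv (by rw [hs]; exact hu)
  refine SimpleGraph.encard_end_eq_of_labelling _ (fun u => ℓ (c u))
    (hK₀.preimage hc.injOn : (c ⁻¹' K₀).Finite) hadj ?_ ?_
  · intro i
    have h : c '' ((fun u => ℓ (c u)) ⁻¹' {i}) = {u | u ∈ A.orbit w ∧ ℓ u = i} := by
      ext u
      constructor
      · rintro ⟨u, hu, rfl⟩
        exact ⟨u.2, hu⟩
      · rintro ⟨hu, hi⟩
        exact ⟨⟨u, hu⟩, hi, rfl⟩
    exact Set.Infinite.of_image c (h ▸ hinf i)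
  · intro F hF
    obtain ⟨K, hKfin, hFK, hKb⟩ := hK (insert w (c '' F ∪ K₀ ∩ A.orbit w))
      ((((hF.image c).union (hK₀.inter_of_left _)).insert w)) (by
        rintro u (rfl | ⟨u, -, rfl⟩ | hu)
        · exact A.mem_orbit_self u
        · exact u.2
        · exact hu.2)
    refine ⟨c ⁻¹' K, hKfin.preimage hc.injOn, fun u hu => hFK (Or.inr (Or.inl ⟨u, hu, rfl⟩)), ?_⟩
    have hK₀K : ∀ u : A.orbit w, c u ∉ K → c u ∉ K₀ := fun u hu hu₀ =>
      hu (hFK (Or.inr (Or.inr ⟨hu₀, u.2⟩)))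
    have hjoin : ∀ x y, A.JoinedOutside K x y → ∀ (hx : x ∈ A.orbit w) (hy : y ∈ A.orbit w)
        (hxK : x ∉ K) (hyK : y ∉ K),
        (A.schreierGraph w).componentComplMk (K := c ⁻¹' K) (v := ⟨x, hx⟩) hxK =
          (A.schreierGraph w).componentComplMk (K := c ⁻¹' K) (v := ⟨y, hy⟩) hyK := by
      intro x y h
      -- Paths outside `K` between words of the orbit stay in the orbit.
      suffices (x ∈ A.orbit w ↔ y ∈ A.orbit w) ∧ (x ∉ K ↔ y ∉ K) ∧
        ∀ (hx : x ∈ A.orbit w) (hy : y ∈ A.orbit w) (hxK : x ∉ K) (hyK : y ∉ K),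
          (A.schreierGraph w).componentComplMk (K := c ⁻¹' K) (v := ⟨x, hx⟩) hxK =
            (A.schreierGraph w).componentComplMk (K := c ⁻¹' K) (v := ⟨y, hy⟩) hyK from this.2.2
      induction h with
      | rel x y h =>
        obtain ⟨hxK, hyK, s, rfl⟩ := h
        refine ⟨A.perm_mem_orbit_iff.symm, iff_of_true hxK hyK, fun hx hy _ _ => ?_⟩
        by_cases h : A.perm s x = x
        · simp only [h]
        · exact SimpleGraph.componentComplMk_eq_of_adj _ _ _ <| A.schreierGraph_adj.2
            ⟨fun h' => h (congrArg Subtype.val h').symm, Or.inl ⟨s, rfl⟩⟩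
      | refl x => exact ⟨Iff.rfl, Iff.rfl, fun _ _ _ _ => rfl⟩
      | symm x y _ ih => exact ⟨ih.1.symm, ih.2.1.symm, fun hx hy hxK hyK => (ih.2.2 hy hx hyK hxK).symm⟩
      | trans x y z _ _ ih ih' =>
        exact ⟨ih.1.trans ih'.1, ih.2.1.trans ih'.2.1, fun hx hz hxK hzK =>
          (ih.2.2 hx (ih.1.1 hx) hxK (ih.2.1.1 hxK)).trans
            (ih'.2.2 (ih.1.1 hx) hz (ih.2.1.1 hxK) hzK)⟩
    have hbd : ∀ u : A.orbit w, c u ∉ K → (∃ k ∈ c ⁻¹' K, (A.schreierGraph w).Adj u k) →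
        c u ∈ A.orbit w ∩ A.outerBoundary K := by
      rintro u hu ⟨k, hk, huk⟩
      refine ⟨u.2, hu, ?_⟩
      obtain ⟨-, ⟨s, hs⟩ | ⟨s, hs⟩⟩ := A.schreierGraph_adj.1 huk
      · exact ⟨s, Or.inl (by rw [hs]; exact hk)⟩
      · exact ⟨s, Or.inr ⟨k, hk, hs⟩⟩
    intro u v hu hv huv
    exact SimpleGraph.componentComplMk_eq_of_boundary _ (A.schreierGraph_preconnected w)
      (fun u => ℓ (c u)) ⟨⟨w, A.mem_orbit_self w⟩, hFK (Or.inl rfl)⟩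
      (fun u v hu hv => hadj u v (hK₀K u hu) (hK₀K v hv))
      (fun u v hu hv hku hkv huv => hjoin _ _ (hKb _ (hbd u hu hku) _ (hbd v hv hkv) huv) _ _ hu hv)
      hu hv huv

end InvertibleAutomaton

/-! ### Cofinality and blocks of words -/

section Words

variable {X : Type*}

theorem mem_cof_iff {ξ η : ℕ → X} : η ∈ cof ξ ↔ ∀ᶠ n in Filter.atTop, ξ n = η n :=
  Filter.eventually_atTop.symm

theorem mem_cof_self (ξ : ℕ → X) : ξ ∈ cof ξ := ⟨0, fun _ _ => rfl⟩

theorem mem_cof_symm {ξ η : ℕ → X} (h : η ∈ cof ξ) : ξ ∈ cof η :=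
  ⟨h.choose, fun n hn => (h.choose_spec n hn).symm⟩

theorem mem_cof_trans {ξ η ζ : ℕ → X} (h : ζ ∈ cof η) (h' : η ∈ cof ξ) : ζ ∈ cof ξ := by
  rw [mem_cof_iff] at *
  filter_upwards [h, h'] with n h1 h2
  rw [h2, h1]

/-- The words that agree with `w` from the position `n` on. -/
def block (n : ℕ) (w : ℕ → X) : Set (ℕ → X) := {x | ∀ k, n ≤ k → x k = w k}

/-- The word `w` with its first `n` letters replaced by `a`. -/
def replacePrefix (n : ℕ) (a : X) (w : ℕ → X) : ℕ → X := fun k => if k < n then a else w k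

theorem replacePrefix_of_lt {n k : ℕ} (h : k < n) (a : X) (w : ℕ → X) :
    replacePrefix n a w k = a := if_pos h

theorem replacePrefix_of_le {n k : ℕ} (h : n ≤ k) (a : X) (w : ℕ → X) :
    replacePrefix n a w k = w k := if_neg h.not_gt

theorem replacePrefix_mem_block (n : ℕ) (a : X) (w : ℕ → X) : replacePrefix n a w ∈ block n w :=
  fun _ hk => replacePrefix_of_le hk a w

theorem eq_replacePrefix {n : ℕ} {a : X} {w x : ℕ → X} (h : ∀ k < n, x k = a)
    (hx : x ∈ block n w) : x = replacePrefix n a w := by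
  funext k
  rcases lt_or_ge k n with hk | hk
  · rw [replacePrefix_of_lt hk, h k hk]
  · rw [replacePrefix_of_le hk, hx k hk]

theorem block_subset_cof (n : ℕ) (w : ℕ → X) : block n w ⊆ cof w :=
  fun _ hx => ⟨n, fun k hk => (hx k hk).symm⟩

theorem replacePrefix_mem_cof (n : ℕ) (a : X) (w : ℕ → X) : replacePrefix n a w ∈ cof w :=
  block_subset_cof n w (replacePrefix_mem_block n a w)

theorem eventually_mem_block {w x : ℕ → X} (h : x ∈ cof w) :
    ∀ᶠ n in Filter.atTop, x ∈ block n w := by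
  obtain ⟨m, hm⟩ := h
  filter_upwards [Filter.eventually_ge_atTop m] with n hn
  exact fun k hk => (hm k (hn.trans hk)).symm

theorem cof_eq_iUnion_block (w : ℕ → X) : cof w = ⋃ n, block n w := by
  refine Subset.antisymm (fun x hx => ?_) (iUnion_subset fun n => block_subset_cof n w)
  exact mem_iUnion.2 (eventually_mem_block hx).exists

theorem finite_block [Finite X] (n : ℕ) (w : ℕ → X) : (block n w).Finite := by
  refine Set.Finite.of_injOn (f := fun x (k : Fin n) => x k) (mapsTo_univ _ _) ?_ finite_univ
  intro x hx y hy hxy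
  funext k
  rcases lt_or_ge k n with hk | hk
  · exact congrFun hxy ⟨k, hk⟩
  · rw [hx k hk, hy k hk]

theorem countable_cof [Finite X] (w : ℕ → X) : (cof w).Countable := by
  rw [cof_eq_iUnion_block]
  exact countable_iUnion fun n => (finite_block n w).countable

/-- The words that are constant from some position on. -/
def eventuallyConstantWords (X : Type*) : Set (ℕ → X) := ⋃ i : X, cof (fun _ => i)

theorem mem_eventuallyConstantWords_of_mem_cof {x y : ℕ → X} (h : y ∈ cof x) :
    y ∈ eventuallyConstantWords X ↔ x ∈ eventuallyConstantWords X := by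
  simp only [eventuallyConstantWords, mem_iUnion]
  exact ⟨fun ⟨i, hi⟩ => ⟨i, mem_cof_trans (mem_cof_symm h) hi⟩,
    fun ⟨i, hi⟩ => ⟨i, mem_cof_trans h hi⟩⟩

theorem const_mem_eventuallyConstantWords (i : X) :
    (fun _ => i : ℕ → X) ∈ eventuallyConstantWords X := mem_iUnion.2 ⟨i, mem_cof_self _⟩

theorem exists_ne_of_notMem_eventuallyConstantWords {w : ℕ → X}
    (hw : w ∉ eventuallyConstantWords X) (a : X) : ∃ᶠ n in Filter.atTop, w n ≠ a := by
  intro h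
  refine hw (mem_iUnion.2 ⟨a, mem_cof_iff.2 ?_⟩)
  filter_upwards [h] with n hn
  exact (not_not.1 hn).symm

/-- A permutation of words leaves a set `K` through a word of `K` that it moves out of `K`. -/
theorem exists_exit {α : Type*} (f : Equiv.Perm α) {K : Set α} {x : α} (hx : x ∈ K)
    (h : ∃ t : ℕ, (f ^ t) x ∉ K) : ∃ t : ℕ, (f ^ t) x ∈ K ∧ f ((f ^ t) x) ∉ K := by
  classical
  have hpos : Nat.find h ≠ 0 := by
    intro h0
    have := Nat.find_spec h
    rw [h0] at this
    exact this hx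
  obtain ⟨t, ht⟩ := Nat.exists_eq_succ_of_ne_zero hpos
  refine ⟨t, not_not.1 (Nat.find_min h (ht ▸ t.lt_succ_self)), ?_⟩
  have := Nat.find_spec h
  rwa [ht, pow_succ', Equiv.Perm.mul_apply] at this

end Words

/-! ### The generators and orbits of the star automaton -/

section Star

variable {p : ℕ}

/-- The generator `e_c` of the star automaton group that belongs to the edge from the centre `0` to
the leaf `c.succ`. -/
def leafPerm (c : Fin p) : Equiv.Perm (ℕ → Fin (p + 1)) := (starAutomaton p).perm (some c)

theorem stateAt_some (c : Fin p) (x : ℕ → Fin (p + 1)) (n : ℕ) :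
    (starAutomaton p).stateAt (some c) x n = if ∀ k < n, x k = 0 then some c else none := by
  induction n with
  | zero => simp [InvertibleAutomaton.stateAt]
  | succ n ih =>
    rw [InvertibleAutomaton.stateAt, ih]
    by_cases h : ∀ k < n, x k = 0
    · by_cases h0 : x n = 0
      · have h' : ∀ k < n + 1, x k = 0 := by
          intro k hk
          rcases Nat.lt_succ_iff_lt_or_eq.1 hk with hk | rfl
          exacts [h k hk, h0]
        rw [if_pos h, if_pos h']
        simp [starAutomaton, graphAutomaton, h0]
      · have h' : ¬ ∀ k < n + 1, x k = 0 := fun h' => h0 (h' n n.lt_succ_self)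
        rw [if_pos h, if_neg h']
        simp [starAutomaton, graphAutomaton, h0]
    · have h' : ¬ ∀ k < n + 1, x k = 0 := fun h' => h fun k hk => h' k (hk.trans n.lt_succ_self)
      rw [if_neg h, if_neg h']
      rfl

/-- The generator `e_c` exchanges `0` and the leaf in every letter up to and including
the first nonzero one. -/
theorem leafPerm_apply (c : Fin p) (x : ℕ → Fin (p + 1)) (n : ℕ) :
    leafPerm c x n = if ∀ k < n, x k = 0 then Equiv.swap 0 c.succ (x n) else x n := by
  change (starAutomaton p).out ((starAutomaton p).stateAt (some c) x n) (x n) = _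
  rw [stateAt_some]
  split_ifs <;> rfl

theorem perm_none (x : ℕ → Fin (p + 1)) : (starAutomaton p).perm none x = x := by
  have h : ∀ n, (starAutomaton p).stateAt none x n = none := by
    intro n
    induction n with
    | zero => rfl
    | succ n ih => rw [InvertibleAutomaton.stateAt, ih]; rfl
  funext n
  change (starAutomaton p).out ((starAutomaton p).stateAt none x n) (x n) = _
  rw [h]
  rfl

theorem leafPerm_of_forall_eq_zero (c : Fin p) {x : ℕ → Fin (p + 1)} {n : ℕ}
    (h : ∀ k < n, x k = 0) : ∀ k < n, leafPerm c x k = c.succ := by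
  intro k hk
  rw [leafPerm_apply, if_pos fun i hi => h i (hi.trans hk), h k hk, Equiv.swap_apply_left]

theorem leafPerm_of_ne_zero (c : Fin p) {x : ℕ → Fin (p + 1)} {n m : ℕ} (h : x n ≠ 0)
    (hm : n < m) : leafPerm c x m = x m := by
  rw [leafPerm_apply, if_neg fun h' => h (h' n hm)]

theorem leafPerm_zero (c : Fin p) : leafPerm c (fun _ => 0) = fun _ => c.succ := by
  funext n
  exact leafPerm_of_forall_eq_zero c (n := n + 1) (fun _ _ => rfl) n n.lt_succ_self

theorem leafPerm_letter_iff (c : Fin p) (x : ℕ → Fin (p + 1)) (n : ℕ) :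
    (leafPerm c x n = 0 ∨ leafPerm c x n = c.succ) ↔ (x n = 0 ∨ x n = c.succ) := by
  rw [leafPerm_apply]
  split_ifs
  · rw [Equiv.swap_apply_eq_iff, Equiv.swap_apply_eq_iff, Equiv.swap_apply_left,
      Equiv.swap_apply_right, or_comm]
  · rfl

theorem leafPerm_of_letter (c : Fin p) {x : ℕ → Fin (p + 1)} {n : ℕ}
    (h : ¬(x n = 0 ∨ x n = c.succ)) {m : ℕ} (hm : n ≤ m) : leafPerm c x m = x m := by
  rw [not_or] at h
  rcases hm.eq_or_lt with rfl | hm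
  · rw [leafPerm_apply, Equiv.swap_apply_of_ne_of_ne h.1 h.2, ite_self]
  · exact leafPerm_of_ne_zero c h.1 hm

theorem leafPerm_forall_letter_iff (c : Fin p) (x : ℕ → Fin (p + 1)) :
    (∀ n, leafPerm c x n = 0 ∨ leafPerm c x n = c.succ) ↔ ∀ n, x n = 0 ∨ x n = c.succ :=
  forall_congr' (leafPerm_letter_iff c x)

/-- Only `0 ^ ∞` is moved to a word that is not cofinal to it. -/
theorem leafPerm_mem_cof (c : Fin p) {x : ℕ → Fin (p + 1)} (h : x ≠ fun _ => 0) :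
    leafPerm c x ∈ cof x := by
  obtain ⟨n, hn⟩ := Function.ne_iff.1 h
  exact ⟨n + 1, fun m hm => (leafPerm_of_ne_zero c hn hm).symm⟩

theorem leafPerm_mem_eventuallyConstantWords_iff (c : Fin p) (x : ℕ → Fin (p + 1)) :
    leafPerm c x ∈ eventuallyConstantWords (Fin (p + 1)) ↔
      x ∈ eventuallyConstantWords (Fin (p + 1)) := by
  by_cases h : x = fun _ => 0
  · rw [h, leafPerm_zero]
    exact iff_of_true (const_mem_eventuallyConstantWords _) (const_mem_eventuallyConstantWords _)
  · exact mem_eventuallyConstantWords_of_mem_cof (leafPerm_mem_cof c h)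

theorem leafPerm_mem_orbit_iff (c : Fin p) {u w : ℕ → Fin (p + 1)} :
    leafPerm c u ∈ (starAutomaton p).orbit w ↔ u ∈ (starAutomaton p).orbit w :=
  (starAutomaton p).perm_mem_orbit_iff

/-- Every prefix can be cleared: a letter `i ≠ 0` at the position `n` is turned into `0` by `e_i`
once all earlier letters are `0`. -/
theorem replacePrefix_zero_mem_orbit (n : ℕ) (x : ℕ → Fin (p + 1)) :
    replacePrefix n 0 x ∈ (starAutomaton p).orbit x := by
  induction n generalizing x with
  | zero =>
    have h : replacePrefix 0 0 x = x := rfl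
    rw [h]
    exact (starAutomaton p).mem_orbit_self x
  | succ n ih =>
    by_cases h0 : x n = 0
    · have h : replacePrefix (n + 1) 0 x = replacePrefix n 0 x := by
        symm
        refine eq_replacePrefix (fun k hk => ?_) fun k hk =>
          replacePrefix_of_le ((Nat.le_succ n).trans hk) _ _
        rcases Nat.lt_succ_iff_lt_or_eq.1 hk with hk | rfl
        · exact replacePrefix_of_lt hk _ _
        · rw [replacePrefix_of_le le_rfl, h0]
      rw [h]
      exact ih x
    · obtain ⟨c, hc⟩ := Fin.exists_succ_eq.2 h0
      have hn : replacePrefix n 0 x n = c.succ := (replacePrefix_of_le le_rfl _ _).trans hc.symm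
      have h : replacePrefix (n + 1) 0 x =
          replacePrefix n 0 (leafPerm c (replacePrefix n 0 x)) := by
        symm
        refine eq_replacePrefix (fun k hk => ?_) fun k hk => ?_
        · rcases Nat.lt_succ_iff_lt_or_eq.1 hk with hk | rfl
          · exact replacePrefix_of_lt hk _ _
          · rw [replacePrefix_of_le le_rfl, leafPerm_apply,
              if_pos fun i hi => replacePrefix_of_lt hi _ _, hn, Equiv.swap_apply_right]
        · have hnk : n ≤ k := (Nat.le_succ n).trans hk
          rw [replacePrefix_of_le hnk,
            leafPerm_of_ne_zero c (n := n) (by rw [hn]; exact Fin.succ_ne_zero c) hk,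
            replacePrefix_of_le hnk]
      rw [h]
      refine (starAutomaton p).mem_orbit_trans (ih _) ?_
      rw [leafPerm_mem_orbit_iff]
      exact ih x

theorem cof_subset_orbit (w : ℕ → Fin (p + 1)) : cof w ⊆ (starAutomaton p).orbit w := by
  intro x hx
  obtain ⟨n, hn⟩ := (eventually_mem_block hx).exists
  have h : replacePrefix n 0 x = replacePrefix n 0 w :=
    eq_replacePrefix (fun k hk => replacePrefix_of_lt hk _ _)
      fun k hk => (replacePrefix_of_le hk _ _).trans (hn k hk)
  refine (starAutomaton p).mem_orbit_trans ?_ (replacePrefix_zero_mem_orbit n w)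
  rw [← h]
  exact (starAutomaton p).mem_orbit_symm (replacePrefix_zero_mem_orbit n x)

/-- The orbit of a word that is not eventually constant is its cofinality class. -/
theorem orbit_eq_cof {w : ℕ → Fin (p + 1)} (hw : w ∉ eventuallyConstantWords (Fin (p + 1))) :
    (starAutomaton p).orbit w = cof w := by
  refine Subset.antisymm ((starAutomaton p).orbit_subset ?_ (mem_cof_self w)) (cof_subset_orbit w)
  rintro (_ | c) u
  · rw [perm_none]
  · change leafPerm c u ∈ cof w ↔ u ∈ cof w
    by_cases h : u = fun _ => 0
    · have hconst : ∀ i : Fin (p + 1), (fun _ => i : ℕ → Fin (p + 1)) ∉ cof w := fun i hi =>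
        hw ((mem_eventuallyConstantWords_of_mem_cof hi).1 (const_mem_eventuallyConstantWords i))
      rw [h, leafPerm_zero]
      exact iff_of_false (hconst _) (hconst _)
    · have hu := leafPerm_mem_cof c h
      exact ⟨fun h' => mem_cof_trans (mem_cof_symm hu) h', fun h' => mem_cof_trans hu h'⟩

/-- The eventually constant words form one orbit. -/
theorem orbit_zero :
    (starAutomaton p).orbit (fun _ => 0) = eventuallyConstantWords (Fin (p + 1)) := by
  refine Subset.antisymm ((starAutomaton p).orbit_subset ?_ (const_mem_eventuallyConstantWords 0))
    (iUnion_subset fun i => ?_)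
  · rintro (_ | c) u
    · rw [perm_none]
    · exact leafPerm_mem_eventuallyConstantWords_iff c u
  · intro x hx
    refine (starAutomaton p).mem_orbit_trans (cof_subset_orbit _ hx) ?_
    rcases Fin.eq_zero_or_eq_succ i with rfl | ⟨c, rfl⟩
    · exact (starAutomaton p).mem_orbit_self _
    · rw [← leafPerm_zero, leafPerm_mem_orbit_iff]
      exact (starAutomaton p).mem_orbit_self _

theorem countable_eventuallyConstantWords :
    (eventuallyConstantWords (Fin (p + 1))).Countable :=
  countable_iUnion fun _ => countable_cof _

theorem countable_orbit (w : ℕ → Fin (p + 1)) : ((starAutomaton p).orbit w).Countable := by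
  by_cases hw : w ∈ eventuallyConstantWords (Fin (p + 1))
  · rw [← orbit_zero] at hw
    rw [(starAutomaton p).orbit_eq_of_mem hw, orbit_zero]
    exact countable_eventuallyConstantWords
  · rw [orbit_eq_cof hw]
    exact countable_cof w

/-- A generator moves at most one word out of a block whose first fixed letter is not `0`. -/
theorem leafPerm_exit_block {c j : Fin p} {n : ℕ} {w x : ℕ → Fin (p + 1)} (hw : w n = j.succ)
    (hx : x ∈ block n w) (hcx : leafPerm c x ∉ block n w) :
    c = j ∧ x = replacePrefix n 0 w := by
  have hxn : x n = j.succ := (hx n le_rfl).trans hw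
  have hx0 : x n ≠ 0 := hxn ▸ Fin.succ_ne_zero j
  have hzero : ∀ k < n, x k = 0 := by
    intro k hk
    by_contra h
    exact hcx fun m hm => (leafPerm_of_ne_zero c h (hk.trans_le hm)).trans (hx m hm)
  refine ⟨?_, eq_replacePrefix hzero hx⟩
  by_contra hcj
  have h : ¬(x n = 0 ∨ x n = c.succ) := by
    rw [not_or, hxn]
    exact ⟨Fin.succ_ne_zero j, fun h => hcj (Fin.succ_injective _ h).symm⟩
  exact hcx fun m hm => (leafPerm_of_letter c h hm).trans (hx m hm)

/-- A generator moves at most one word into a block whose first fixed letter is not `0`. -/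
theorem leafPerm_enter_block {c j : Fin p} {n : ℕ} {w x : ℕ → Fin (p + 1)} (hw : w n = j.succ)
    (hx : x ∉ block n w) (hcx : leafPerm c x ∈ block n w) :
    c = j ∧ leafPerm c x = replacePrefix n j.succ w := by
  have hzero : ∀ k < n, x k = 0 := by
    intro k hk
    by_contra h
    exact hx fun m hm => (leafPerm_of_ne_zero c h (hk.trans_le hm)).symm.trans (hcx m hm)
  have hcj : c = j := by
    by_contra hcj
    have h : ¬(leafPerm c x n = 0 ∨ leafPerm c x n = c.succ) := by
      rw [not_or, hcx n le_rfl, hw]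
      exact ⟨Fin.succ_ne_zero j, fun h => hcj (Fin.succ_injective _ h).symm⟩
    rw [leafPerm_letter_iff] at h
    exact hx fun m hm => (leafPerm_of_letter c h hm).symm.trans (hcx m hm)
  subst hcj
  exact ⟨rfl, eq_replacePrefix (leafPerm_of_forall_eq_zero c hzero) hcx⟩

/-- Only two words lie next to a block whose first fixed letter is not `0`. -/
theorem outerBoundary_block {j : Fin p} {n : ℕ} {w u : ℕ → Fin (p + 1)} (hw : w n = j.succ)
    (hu : u ∈ (starAutomaton p).outerBoundary (block n w)) :
    u = leafPerm j (replacePrefix n 0 w) ∨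
      u = (leafPerm j).symm (replacePrefix n j.succ w) := by
  obtain ⟨huK, s, h | ⟨x, hx, rfl⟩⟩ := hu
  · rcases s with _ | c
    · rw [perm_none] at h
      exact absurd h huK
    · obtain ⟨rfl, h⟩ := leafPerm_enter_block hw huK h
      exact Or.inr (by rw [← h, Equiv.symm_apply_apply])
  · rcases s with _ | c
    · rw [perm_none] at huK
      exact absurd hx huK
    · obtain ⟨rfl, h⟩ := leafPerm_exit_block hw hx huK
      exact Or.inl (by rw [← h]; rfl)

end Star

/-! ### The odometer on the words over two letters -/

section Line

variable {p : ℕ}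

/-- The words over `{0, j.succ}`.  On them `e_j` acts as the binary odometer. -/
def binaryWords (j : Fin p) : Set (ℕ → Fin (p + 1)) := {x | ∀ n, x n = 0 ∨ x n = j.succ}

theorem leafPerm_mem_binaryWords_iff (j : Fin p) (x : ℕ → Fin (p + 1)) :
    leafPerm j x ∈ binaryWords j ↔ x ∈ binaryWords j := leafPerm_forall_letter_iff j x

theorem leafPerm_zpow_mem_binaryWords (j : Fin p) {x : ℕ → Fin (p + 1)} (hx : x ∈ binaryWords j)
    (t : ℤ) : (leafPerm j ^ t) x ∈ binaryWords j := by
  induction t with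
  | zero => exact hx
  | succ t ih =>
    rw [add_comm (t : ℤ), zpow_one_add, Equiv.Perm.mul_apply]
    exact (leafPerm_mem_binaryWords_iff j _).2 ih
  | pred t ih =>
    rw [← leafPerm_mem_binaryWords_iff, ← Equiv.Perm.mul_apply, ← zpow_one_add]
    rwa [add_sub_cancel]

/-- Two steps of the odometer change the first letter twice and move the tail by one step. -/
theorem leafPerm_leafPerm (j : Fin p) {x : ℕ → Fin (p + 1)} (hx : x ∈ binaryWords j) (n : ℕ) :
    leafPerm j (leafPerm j x) (n + 1) = leafPerm j (fun k => x (k + 1)) n := by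
  have hshift : ∀ y : ℕ → Fin (p + 1), y 0 = 0 →
      leafPerm j y (n + 1) = leafPerm j (fun k => y (k + 1)) n := by
    intro y hy
    rw [leafPerm_apply, leafPerm_apply]
    congr 1
    refine propext ⟨fun h k hk => h (k + 1) (Nat.succ_lt_succ hk), fun h k hk => ?_⟩
    rcases k with _ | k
    · exact hy
    · exact h k (Nat.lt_of_succ_lt_succ hk)
  have h0 : leafPerm j x 0 = Equiv.swap 0 j.succ (x 0) := by simp [leafPerm_apply]
  rcases hx 0 with h | h
  · rw [h, Equiv.swap_apply_left] at h0
    rw [leafPerm_of_ne_zero j (n := 0) (by rw [h0]; exact Fin.succ_ne_zero j) n.succ_pos,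
      hshift x h]
  · rw [h, Equiv.swap_apply_right] at h0
    rw [hshift _ h0]
    refine congrFun (congrArg _ ?_) n
    funext k
    exact leafPerm_of_ne_zero j (n := 0) (by rw [h]; exact Fin.succ_ne_zero j) k.succ_pos

/-- The odometer has no periodic points. -/
theorem leafPerm_pow_ne (j : Fin p) {x : ℕ → Fin (p + 1)} (hx : x ∈ binaryWords j) {t : ℕ}
    (ht : 0 < t) : (leafPerm j ^ t) x ≠ x := by
  induction t using Nat.strong_induction_on generalizing x with
  | _ t ih =>
  have hmem : ∀ s : ℕ, (leafPerm j ^ s) x ∈ binaryWords j := fun s => by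
    have := leafPerm_zpow_mem_binaryWords j hx s
    rwa [zpow_natCast] at this
  have hdouble : ∀ s n : ℕ,
      (leafPerm j ^ (2 * s)) x (n + 1) = (leafPerm j ^ s) (fun k => x (k + 1)) n := by
    intro s
    induction s with
    | zero => exact fun n => rfl
    | succ s ihs =>
      intro n
      rw [show 2 * (s + 1) = 2 * s + 1 + 1 by ring, pow_succ', pow_succ', Equiv.Perm.mul_apply,
        Equiv.Perm.mul_apply, leafPerm_leafPerm j (hmem _), pow_succ', Equiv.Perm.mul_apply]
      refine congrFun (congrArg _ ?_) n
      funext k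
      exact ihs k
  have hfirst : ∀ y : ℕ → Fin (p + 1), leafPerm j y 0 = Equiv.swap 0 j.succ (y 0) := fun y => by
    simp [leafPerm_apply]
  have hfirst2 : ∀ s : ℕ, (leafPerm j ^ (2 * s)) x 0 = x 0 := by
    intro s
    induction s with
    | zero => rfl
    | succ s ihs =>
      rw [show 2 * (s + 1) = 2 * s + 1 + 1 by ring, pow_succ', pow_succ', Equiv.Perm.mul_apply,
        Equiv.Perm.mul_apply, hfirst, hfirst, Equiv.swap_apply_self, ihs]
  intro hper
  obtain ⟨s, rfl | rfl⟩ := t.even_or_odd'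
  · refine ih s (by omega) (x := fun k => x (k + 1)) (fun n => hx (n + 1)) (by omega) ?_
    funext n
    rw [← hdouble, hper]
  · -- An odd number of steps changes the first letter.
    have h := congrFun hper 0
    rw [pow_succ', Equiv.Perm.mul_apply, hfirst, hfirst2] at h
    rcases hx 0 with h0 | h0
    · rw [h0, Equiv.swap_apply_left] at h
      exact Fin.succ_ne_zero j h
    · rw [h0, Equiv.swap_apply_right] at h
      exact Fin.succ_ne_zero j h.symm

theorem leafPerm_zpow_injective (j : Fin p) {x : ℕ → Fin (p + 1)} (hx : x ∈ binaryWords j) :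
    Function.Injective fun t : ℤ => (leafPerm j ^ t) x := by
  have aux : ∀ s t : ℤ, s < t → (leafPerm j ^ s) x ≠ (leafPerm j ^ t) x := by
    intro s t hst h
    obtain ⟨n, hn⟩ := Int.eq_ofNat_of_zero_le (sub_nonneg.2 hst.le)
    refine leafPerm_pow_ne j (leafPerm_zpow_mem_binaryWords j hx s) (t := n) (by omega) ?_
    rw [← zpow_natCast, ← Equiv.Perm.mul_apply, ← zpow_add, ← hn, sub_add_cancel]
    exact h.symm
  intro s t h
  rcases lt_trichotomy s t with hst | hst | hst
  exacts [absurd h (aux s t hst), hst, absurd h.symm (aux t s hst)]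

open Classical in
/-- The projection of a word to the line of the words over `{0, j.succ}`: all letters up to the last
letter outside `{0, j.succ}` are replaced by `0`, which gives `0 ^ ∞` if there are infinitely many. -/
noncomputable def lineProj (j : Fin p) (x : ℕ → Fin (p + 1)) : ℕ → Fin (p + 1) :=
  fun n => if ∃ m, n ≤ m ∧ ¬(x m = 0 ∨ x m = j.succ) then 0 else x n

theorem lineProj_of_mem {j : Fin p} {x : ℕ → Fin (p + 1)} (hx : x ∈ binaryWords j) :
    lineProj j x = x := by
  funext n
  exact if_neg fun ⟨m, _, hm⟩ => hm (hx m)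

theorem lineProj_congr (j : Fin p) {x y : ℕ → Fin (p + 1)} {n : ℕ} (h : ∀ m, n ≤ m → x m = y m) :
    lineProj j x n = lineProj j y n := by
  unfold lineProj
  have : (∃ m, n ≤ m ∧ ¬(x m = 0 ∨ x m = j.succ)) ↔ ∃ m, n ≤ m ∧ ¬(y m = 0 ∨ y m = j.succ) :=
    exists_congr fun m => and_congr_right fun hm => by rw [h m hm]
  by_cases hx : ∃ m, n ≤ m ∧ ¬(x m = 0 ∨ x m = j.succ)
  · rw [if_pos hx, if_pos (this.1 hx)]
  · rw [if_neg hx, if_neg fun hy => hx (this.2 hy), h n le_rfl]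

theorem lineProj_eq_zero {j c : Fin p} (hcj : c ≠ j) {x : ℕ → Fin (p + 1)} {n : ℕ}
    (h : x n = 0 ∨ x n = c.succ) : lineProj j x n = 0 := by
  unfold lineProj
  split_ifs with hm
  · rfl
  · rcases h with h | h
    · exact h
    · refine absurd ⟨n, le_rfl, ?_⟩ hm
      rw [not_or, h]
      exact ⟨Fin.succ_ne_zero c, fun h => hcj (Fin.succ_injective _ h)⟩

theorem lineProj_leafPerm_of_ne {j c : Fin p} (hcj : c ≠ j) (x : ℕ → Fin (p + 1)) :
    lineProj j (leafPerm c x) = lineProj j x := by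
  funext n
  by_cases h : x n = 0 ∨ x n = c.succ
  · rw [lineProj_eq_zero hcj h, lineProj_eq_zero hcj ((leafPerm_letter_iff c x n).2 h)]
  · exact lineProj_congr j fun m hm => leafPerm_of_letter c h hm

theorem lineProj_leafPerm_self {j : Fin p} {x : ℕ → Fin (p + 1)} (hx : x ∉ binaryWords j) :
    lineProj j (leafPerm j x) = lineProj j x := by
  obtain ⟨m, hm⟩ := not_forall.1 hx
  funext n
  rcases le_total n m with hnm | hmn
  · have h1 : ∃ k, n ≤ k ∧ ¬(x k = 0 ∨ x k = j.succ) := ⟨m, hnm, hm⟩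
    have h2 : ∃ k, n ≤ k ∧ ¬(leafPerm j x k = 0 ∨ leafPerm j x k = j.succ) :=
      ⟨m, hnm, by rwa [leafPerm_letter_iff]⟩
    unfold lineProj
    rw [if_pos h1, if_pos h2]
  · exact lineProj_congr j fun k hk => leafPerm_of_letter j hm (hmn.trans hk)

end Line

/-! ### Graphs with one or two ends -/

section Ends

variable {p : ℕ}

theorem encard_end_eq_of_mem_orbit {u w : ℕ → Fin (p + 1)} (h : u ∈ (starAutomaton p).orbit w) :
    ((starAutomaton p).schreierGraph u).end.encard =
      ((starAutomaton p).schreierGraph w).end.encard := by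
  let G : (O : Set (ℕ → Fin (p + 1))) → SimpleGraph O := fun O =>
    SimpleGraph.fromRel fun u v => ∃ s, (starAutomaton p).perm s u = (v : ℕ → Fin (p + 1))
  have hG : ∀ O O', O = O' → (G O).end.encard = (G O').end.encard := by
    rintro O _ rfl
    rfl
  exact hG _ _ ((starAutomaton p).orbit_eq_of_mem h)

theorem exists_block_of_frequently {w : ℕ → Fin (p + 1)} {P : ℕ → Prop}
    (hP : ∃ᶠ n in Filter.atTop, P n) {F : Set (ℕ → Fin (p + 1))} (hF : F.Finite)
    (hFw : F ⊆ cof w) : ∃ n, P n ∧ F ⊆ block n w := by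
  have h : ∀ᶠ n in Filter.atTop, ∀ x ∈ F, x ∈ block n w :=
    (Filter.eventually_all_finite hF).2 fun x hx => eventually_mem_block (hFw hx)
  exact (hP.and_eventually h).exists

/-- If `w` is not eventually over `{0, j.succ}`, then its orbit under `e_j` is a finite cycle. -/
theorem exists_pow_leafPerm_eq_self (j : Fin p) {w : ℕ → Fin (p + 1)}
    (hw : ∃ m, ¬(w m = 0 ∨ w m = j.succ)) : ∃ t : ℕ, 0 < t ∧ (leafPerm j ^ t) w = w := by
  obtain ⟨m, hm⟩ := hw
  have hmem : ∀ t : ℕ, (leafPerm j ^ t) w ∈ block m w := by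
    intro t
    induction t with
    | zero => exact fun _ _ => rfl
    | succ t ih =>
      intro k hk
      rw [pow_succ', Equiv.Perm.mul_apply,
        leafPerm_of_letter j (n := m) (by rwa [ih m le_rfl]) hk, ih k hk]
  obtain ⟨s, t, hst, h⟩ := (finite_block m w).exists_lt_map_eq_of_forall_mem hmem
  refine ⟨t - s, by omega, ?_⟩
  apply (leafPerm j ^ s).injective
  rw [← Equiv.Perm.mul_apply, ← pow_add, Nat.add_sub_cancel' hst.le]
  exact h.symm

/-- If `e_j` has a finite cycle through `0 ^ n w`, then the arc of that cycle outside the block joins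
the two words next to the block. -/
theorem joinedOutside_block {j : Fin p} {n : ℕ} {w : ℕ → Fin (p + 1)} (hw : w n = j.succ)
    (hcycle : ∃ t : ℕ, 0 < t ∧ (leafPerm j ^ t) (replacePrefix n 0 w) = replacePrefix n 0 w)
    (ha : leafPerm j (replacePrefix n 0 w) ∉ block n w) :
    (starAutomaton p).JoinedOutside (block n w) (leafPerm j (replacePrefix n 0 w))
      ((leafPerm j).symm (replacePrefix n j.succ w)) := by
  classical
  set a := leafPerm j (replacePrefix n 0 w) with ha_def
  -- Follow the cycle from `a` until it first returns to the block.
  have hreturn : ∃ t : ℕ, (leafPerm j ^ t) a ∈ block n w := by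
    obtain ⟨t, ht, h⟩ := hcycle
    refine ⟨t - 1, ?_⟩
    rw [ha_def, ← Equiv.Perm.mul_apply, ← pow_succ, Nat.sub_add_cancel ht, h]
    exact replacePrefix_mem_block n 0 w
  have hpos : Nat.find hreturn ≠ 0 := by
    intro h0
    have := Nat.find_spec hreturn
    rw [h0] at this
    exact ha this
  obtain ⟨t, ht⟩ := Nat.exists_eq_succ_of_ne_zero hpos
  have hout : ∀ s ≤ t, (leafPerm j ^ s) a ∉ block n w := fun s hs =>
    Nat.find_min hreturn (by omega)
  have hin : leafPerm j ((leafPerm j ^ t) a) ∈ block n w := by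
    have := Nat.find_spec hreturn
    rwa [ht, pow_succ', Equiv.Perm.mul_apply] at this
  have hlast : (leafPerm j).symm (replacePrefix n j.succ w) = (leafPerm j ^ t) a := by
    rw [← (leafPerm_enter_block hw (hout t le_rfl) hin).2, Equiv.symm_apply_apply]
  rw [hlast]
  have hjoin : ∀ s ≤ t, (starAutomaton p).JoinedOutside (block n w) a ((leafPerm j ^ s) a) := by
    intro s
    induction s with
    | zero => exact fun _ => .refl _
    | succ s ih =>
      intro hs
      refine .trans _ _ _ (ih (by omega)) (.rel _ _ ⟨hout s (by omega), hout _ hs, some j, ?_⟩)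
      rw [pow_succ', Equiv.Perm.mul_apply]
      rfl
  exact hjoin t le_rfl

/-- A word that is not eventually over `{0, i}` for any leaf `i` has a Schreier graph with one end:
blocks that end before a nonzero letter of `w` have a connected complement. -/
theorem encard_end_eq_one {w : ℕ → Fin (p + 1)}
    (hw : w ∉ eventuallyConstantWords (Fin (p + 1)))
    (hbin : ∀ j : Fin p, ∃ᶠ m in Filter.atTop, ¬(w m = 0 ∨ w m = j.succ)) :
    ((starAutomaton p).schreierGraph w).end.encard = 1 := by
  have hfreq := exists_ne_of_notMem_eventuallyConstantWords hw 0
  have hone : ENat.card Unit = 1 := by simp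
  rw [← hone]
  refine (starAutomaton p).encard_end_schreierGraph w (fun _ => ()) finite_empty
    (fun _ _ _ _ _ => rfl) (fun _ => ?_) fun F hF hFw => ?_
  · have hinf : {n | w n ≠ 0}.Infinite := Nat.frequently_atTop_iff_infinite.1 hfreq
    refine infinite_of_injOn_mapsTo (f := fun n => replacePrefix n 0 w) ?_ ?_ hinf
    · have aux : ∀ m n, w m ≠ 0 → m < n → replacePrefix m 0 w ≠ replacePrefix n 0 w := by
        intro m n hm hmn h
        have := congrFun h m
        rw [replacePrefix_of_le le_rfl, replacePrefix_of_lt hmn] at this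
        exact hm this
      intro m hm n hn h
      rcases lt_trichotomy m n with hmn | hmn | hmn
      exacts [absurd h (aux m n hm hmn), hmn, absurd h.symm (aux n m hn hmn)]
    · exact fun n _ => ⟨replacePrefix_zero_mem_orbit n w, rfl⟩
  · rw [orbit_eq_cof hw] at hFw
    obtain ⟨n, hn, hFn⟩ := exists_block_of_frequently hfreq hF hFw
    obtain ⟨j, hj⟩ := Fin.exists_succ_eq.2 hn
    refine ⟨block n w, finite_block n w, hFn, fun u hu v hv _ => ?_⟩
    have hcycle := exists_pow_leafPerm_eq_self j (w := replacePrefix n 0 w) (by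
      obtain ⟨m, hm, hnm⟩ := ((hbin j).and_eventually (Filter.eventually_ge_atTop n)).exists
      exact ⟨m, by rwa [replacePrefix_of_le hnm]⟩)
    rcases outerBoundary_block hj.symm hu.2 with rfl | rfl <;>
      rcases outerBoundary_block hj.symm hv.2 with rfl | rfl
    · exact .refl _
    · exact joinedOutside_block hj.symm hcycle hu.2.1
    · exact .symm _ _ (joinedOutside_block hj.symm hcycle hv.2.1)
    · exact .refl _

/-- A word over `{0, j.succ}` that is not eventually constant has a Schreier graph with two ends,
the two directions of the line of the words over `{0, j.succ}`. -/
theorem encard_end_eq_two {j : Fin p} {w : ℕ → Fin (p + 1)}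
    (hw : w ∉ eventuallyConstantWords (Fin (p + 1))) (hbin : w ∈ binaryWords j) :
    ((starAutomaton p).schreierGraph w).end.encard = 2 := by
  have hfreq := exists_ne_of_notMem_eventuallyConstantWords hw 0
  have htwo : ENat.card Prop = 2 := by simp
  rw [← htwo]
  -- The label tells whether a word projects to the forward half of the line, which starts at `w`.
  let ℓ : (ℕ → Fin (p + 1)) → Prop := fun x => ∃ t : ℕ, lineProj j x = (leafPerm j ^ t) w
  have hℓ : ∀ t : ℤ, ℓ ((leafPerm j ^ t) w) ↔ 0 ≤ t := by
    intro t
    change (∃ s : ℕ, _) ↔ _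
    rw [lineProj_of_mem (leafPerm_zpow_mem_binaryWords j hbin t)]
    constructor
    · rintro ⟨s, hs⟩
      rw [← zpow_natCast] at hs
      rw [leafPerm_zpow_injective j hbin hs]
      exact Int.natCast_nonneg s
    · intro ht
      obtain ⟨n, rfl⟩ := Int.eq_ofNat_of_zero_le ht
      exact ⟨n, by rw [zpow_natCast]⟩
  have hmem : ∀ t : ℤ, (leafPerm j ^ t) w ∈ (starAutomaton p).orbit w := fun t =>
    ⟨⟨leafPerm j ^ t, zpow_mem ((starAutomaton p).perm_mem_group (some j)) t⟩, rfl⟩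
  refine (starAutomaton p).encard_end_schreierGraph w ℓ (finite_singleton w) ?_ ?_ ?_
  · rintro (_ | c) u - hu hcu
    · rw [perm_none]
    · change leafPerm c u ∉ ({w} : Set _) at hcu
      change ℓ (leafPerm c u) = ℓ u
      by_cases hc : c = j
      · subst hc
        by_cases hub : u ∈ binaryWords c
        · change (∃ t : ℕ, _) = ∃ t : ℕ, _
          rw [lineProj_of_mem hub, lineProj_of_mem ((leafPerm_mem_binaryWords_iff c u).2 hub)]
          refine propext ⟨?_, ?_⟩
          · rintro ⟨_ | t, ht⟩
            · exact absurd ht hcu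
            · rw [pow_succ', Equiv.Perm.mul_apply] at ht
              exact ⟨t, (leafPerm c).injective ht⟩
          · rintro ⟨t, rfl⟩
            exact ⟨t + 1, by rw [pow_succ', Equiv.Perm.mul_apply]⟩
        · simp only [ℓ, lineProj_leafPerm_self hub]
      · simp only [ℓ, lineProj_leafPerm_of_ne hc]
  · intro i
    by_cases hi : i
    · refine infinite_of_injOn_mapsTo (leafPerm_zpow_injective j hbin).injOn ?_
        (Ici_infinite (0 : ℤ))
      exact fun t ht => ⟨hmem t, propext (iff_of_true ((hℓ t).2 ht) hi)⟩
    · refine infinite_of_injOn_mapsTo (leafPerm_zpow_injective j hbin).injOn ?_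
        (Iio_infinite (0 : ℤ))
      exact fun t ht => ⟨hmem t, propext (iff_of_false (fun h => not_le.2 ht ((hℓ t).1 h)) hi)⟩
  · intro F hF hFw
    rw [orbit_eq_cof hw] at hFw
    obtain ⟨n, hn, hFn⟩ := exists_block_of_frequently hfreq hF hFw
    have hj : w n = j.succ := (hbin n).resolve_left hn
    have hwn : w ∈ block n w := fun _ _ => rfl
    -- The line leaves the finite block in both directions.
    have hleave : ∀ ε : ℤ, ε ≠ 0 → ∃ t : ℕ, ((leafPerm j ^ ε) ^ t) w ∉ block n w := by
      intro ε hε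
      by_contra! h
      refine Set.infinite_of_injective_forall_mem (f := fun t : ℕ => ((leafPerm j ^ ε) ^ t) w) ?_
        h (finite_block n w)
      intro s t hst
      simp only [← zpow_natCast, ← zpow_mul] at hst
      exact_mod_cast mul_left_cancel₀ hε (leafPerm_zpow_injective j hbin hst)
    -- The exits are the two words next to the block, so these lie on different sides of `w`.
    have ha : ℓ (leafPerm j (replacePrefix n 0 w)) := by
      obtain ⟨t, ht, ht'⟩ := exists_exit (leafPerm j ^ (1 : ℤ)) hwn (hleave 1 one_ne_zero)
      rw [zpow_one] at ht ht'
      rw [← (leafPerm_exit_block hj ht ht').2, ← Equiv.Perm.mul_apply, ← pow_succ', ← zpow_natCast]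
      exact (hℓ _).2 (Int.natCast_nonneg _)
    have hb : ¬ ℓ ((leafPerm j).symm (replacePrefix n j.succ w)) := by
      obtain ⟨t, ht, ht'⟩ := exists_exit (leafPerm j ^ (-1 : ℤ)) hwn (hleave (-1) (by decide))
      have hback : leafPerm j ((leafPerm j ^ (-1 : ℤ)) (((leafPerm j ^ (-1 : ℤ)) ^ t) w)) =
          ((leafPerm j ^ (-1 : ℤ)) ^ t) w := by
        rw [zpow_neg_one]
        exact (leafPerm j).apply_symm_apply _
      have h := (leafPerm_enter_block hj ht' (by rw [hback]; exact ht)).2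
      rw [← h, Equiv.symm_apply_apply, ← Equiv.Perm.mul_apply, ← pow_succ', ← zpow_natCast,
        ← zpow_mul, hℓ]
      omega
    refine ⟨block n w, finite_block n w, hFn, fun u hu v hv huv => ?_⟩
    rcases outerBoundary_block hj hu.2 with rfl | rfl <;>
      rcases outerBoundary_block hj hv.2 with rfl | rfl
    · exact .refl _
    · exact absurd (huv ▸ ha) hb
    · exact absurd (huv.symm ▸ ha) hb
    · exact .refl _

end Ends

/-! ### The graph of the eventually constant words -/

section EventuallyConstant

variable {p : ℕ}

/-- From some occurrence of the letter `j.succ` on, all letters of `x` are `0` or `j.succ`.  For an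
eventually constant word, `j.succ` is the letter repeated at the end, or the last nonzero letter if
the word is eventually `0`. -/
def HasColour (x : ℕ → Fin (p + 1)) (j : Fin p) : Prop :=
  ∃ m, x m = j.succ ∧ ∀ k, m ≤ k → x k = 0 ∨ x k = j.succ

theorem HasColour.unique {x : ℕ → Fin (p + 1)} {i j : Fin p} (hi : HasColour x i)
    (hj : HasColour x j) : i = j := by
  have aux : ∀ {i j : Fin p} {m n : ℕ}, (∀ k, m ≤ k → x k = 0 ∨ x k = i.succ) → x n = j.succ →
      m ≤ n → j = i := by
    intro i j m n hi hj hmn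
    rcases hi n hmn with h | h
    · exact absurd (hj.symm.trans h) (Fin.succ_ne_zero j)
    · exact Fin.succ_injective _ (hj.symm.trans h)
  obtain ⟨m, hm, hmi⟩ := hi
  obtain ⟨n, hn, hnj⟩ := hj
  rcases le_total m n with h | h
  · exact (aux hmi hn h).symm
  · exact aux hnj hm h

theorem hasColour_of_mem_binaryWords {x : ℕ → Fin (p + 1)} {c : Fin p} (hx : x ∈ binaryWords c)
    (h0 : x ≠ fun _ => 0) : HasColour x c := by
  obtain ⟨n, hn⟩ := Function.ne_iff.1 h0
  exact ⟨n, (hx n).resolve_left hn, fun k _ => hx k⟩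

theorem HasColour.congr {x y : ℕ → Fin (p + 1)} {j : Fin p} {n : ℕ} (hx : HasColour x j)
    (hn : x n ≠ 0) (h : ∀ m, n ≤ m → x m = y m) : HasColour y j := by
  obtain ⟨m, hm, hmj⟩ := hx
  rcases le_total n m with hnm | hmn
  · exact ⟨m, (h m hnm).symm.trans hm, fun k hk => h k (hnm.trans hk) ▸ hmj k hk⟩
  · exact ⟨n, (h n le_rfl).symm.trans ((hmj n hmn).resolve_left hn),
      fun k hk => h k hk ▸ hmj k (hmn.trans hk)⟩

theorem hasColour_leafPerm_iff {c : Fin p} {x : ℕ → Fin (p + 1)} (hx : x ≠ fun _ => 0)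
    (hcx : leafPerm c x ≠ fun _ => 0) (j : Fin p) :
    HasColour (leafPerm c x) j ↔ HasColour x j := by
  by_cases h : x ∈ binaryWords c
  · have h1 := hasColour_of_mem_binaryWords h hx
    have h2 := hasColour_of_mem_binaryWords ((leafPerm_mem_binaryWords_iff c x).2 h) hcx
    constructor
    · intro hj
      rwa [hj.unique h2]
    · intro hj
      rwa [hj.unique h1]
  · obtain ⟨n, hn⟩ := not_forall.1 h
    have hn0 : x n ≠ 0 := fun h0 => hn (Or.inl h0)
    have heq : ∀ m, n ≤ m → leafPerm c x m = x m := fun m hm => leafPerm_of_letter c hn hm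
    exact ⟨fun hj => hj.congr (by rwa [heq n le_rfl]) heq,
      fun hj => hj.congr hn0 fun m hm => (heq m hm).symm⟩

/-- Infinitely many letters of `x` are nonzero. -/
def InfinitelyManyNonzero (x : ℕ → Fin (p + 1)) : Prop := ∃ᶠ n in Filter.atTop, x n ≠ 0

theorem infinitelyManyNonzero_iff_of_mem_cof {x y : ℕ → Fin (p + 1)} (h : y ∈ cof x) :
    InfinitelyManyNonzero y ↔ InfinitelyManyNonzero x :=
  Filter.frequently_congr ((mem_cof_iff.1 h).mono fun n hn => by rw [hn])

open Classical in
/-- The direction of an eventually constant word other than `0 ^ ∞`, as seen from `0 ^ ∞`: the line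
`{0, j.succ} ^ ∞` it is attached to, and the side of `0 ^ ∞` on which it is attached to that line.
The words on the positive side end with `j.succ ^ ∞`, those on the negative side with `0 ^ ∞`. -/
noncomputable def direction [Nonempty (Fin p)] (x : ℕ → Fin (p + 1)) : Fin p × Bool :=
  (Classical.epsilon (HasColour x), decide (InfinitelyManyNonzero x))

theorem direction_eq_iff [Nonempty (Fin p)] {x : ℕ → Fin (p + 1)} {j : Fin p}
    (hj : HasColour x j) (d : Fin p × Bool) :
    direction x = d ↔ j = d.1 ∧ (InfinitelyManyNonzero x ↔ d.2 = true) := by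
  have h : Classical.epsilon (HasColour x) = j := (Classical.epsilon_spec ⟨j, hj⟩).unique hj
  rw [direction, h, Prod.ext_iff]
  exact and_congr_right fun _ => by
    rw [Bool.eq_iff_iff, @decide_eq_true_iff _ (Classical.propDecidable _)]

theorem direction_leafPerm [Nonempty (Fin p)] {c : Fin p} {x : ℕ → Fin (p + 1)}
    (hx : x ≠ fun _ => 0) (hcx : leafPerm c x ≠ fun _ => 0) :
    direction (leafPerm c x) = direction x := by
  have h1 : HasColour (leafPerm c x) = HasColour x :=
    funext fun j => propext (hasColour_leafPerm_iff hx hcx j)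
  have h2 := infinitelyManyNonzero_iff_of_mem_cof (leafPerm_mem_cof c hx)
  exact Prod.ext (congrArg Classical.epsilon h1) (@decide_eq_decide _ _ (_) (_) |>.2 h2)

/-- The words that are constant from the position `n` on. -/
def constantFrom (p n : ℕ) : Set (ℕ → Fin (p + 1)) := ⋃ i, block n fun _ => i

theorem mem_constantFrom_congr {x y : ℕ → Fin (p + 1)} {n : ℕ} (h : ∀ m, n ≤ m → x m = y m)
    (hx : x ∈ constantFrom p n) : y ∈ constantFrom p n := by
  obtain ⟨i, hi⟩ := mem_iUnion.1 hx
  exact mem_iUnion.2 ⟨i, fun k hk => (h k hk).symm.trans (hi k hk)⟩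

theorem const_mem_constantFrom (n : ℕ) (i : Fin (p + 1)) : (fun _ => i) ∈ constantFrom p n :=
  mem_iUnion.2 ⟨i, fun _ _ => rfl⟩

theorem forall_eq_zero_of_constantFrom {c : Fin p} {n : ℕ} {x : ℕ → Fin (p + 1)}
    (h : ¬(leafPerm c x ∈ constantFrom p n ↔ x ∈ constantFrom p n)) : ∀ k < n, x k = 0 := by
  intro k hk
  by_contra h0
  have heq : ∀ m, n ≤ m → leafPerm c x m = x m := fun m hm =>
    leafPerm_of_ne_zero c h0 (hk.trans_le hm)
  exact h ⟨mem_constantFrom_congr heq, mem_constantFrom_congr fun m hm => (heq m hm).symm⟩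

theorem letter_of_constantFrom {c : Fin p} {n : ℕ} {x : ℕ → Fin (p + 1)}
    (h : ¬(leafPerm c x ∈ constantFrom p n ↔ x ∈ constantFrom p n)) :
    x n = 0 ∨ x n = c.succ := by
  by_contra h0
  have heq : ∀ m, n ≤ m → leafPerm c x m = x m := fun m hm => leafPerm_of_letter c h0 hm
  exact h ⟨mem_constantFrom_congr heq, mem_constantFrom_congr fun m hm => (heq m hm).symm⟩

/-- The word `e_c (0 ^ n c ^ ∞)` is the only one by which the generator `e_c` leaves
`constantFrom p n`. -/
theorem leafPerm_exit_constantFrom {c : Fin p} {n : ℕ} {x : ℕ → Fin (p + 1)}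
    (hx : x ∈ constantFrom p n) (hcx : leafPerm c x ∉ constantFrom p n) :
    x = replacePrefix n 0 fun _ => c.succ := by
  have h : ¬(leafPerm c x ∈ constantFrom p n ↔ x ∈ constantFrom p n) := fun h => hcx (h.2 hx)
  have hzero := forall_eq_zero_of_constantFrom h
  obtain ⟨i, hi⟩ := mem_iUnion.1 hx
  have hxi := hi n le_rfl
  rcases letter_of_constantFrom h with h0 | h0
  · have hx0 : x = fun _ => 0 := by
      funext k
      rcases lt_or_ge k n with hk | hk
      · exact hzero k hk
      · rw [hi k hk, ← hxi, h0]
    rw [hx0, leafPerm_zero] at hcx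
    exact absurd (const_mem_constantFrom n _) hcx
  · rw [h0] at hxi
    subst hxi
    exact eq_replacePrefix hzero hi

/-- The word `e_c⁻¹ (c ^ n 0 ^ ∞)` is the only one by which the generator `e_c` enters
`constantFrom p n`. -/
theorem leafPerm_enter_constantFrom {c : Fin p} {n : ℕ} {x : ℕ → Fin (p + 1)}
    (hx : x ∉ constantFrom p n) (hcx : leafPerm c x ∈ constantFrom p n) :
    leafPerm c x = replacePrefix n c.succ fun _ => 0 := by
  have h : ¬(leafPerm c x ∈ constantFrom p n ↔ x ∈ constantFrom p n) := fun h => hx (h.1 hcx)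
  have hprefix := leafPerm_of_forall_eq_zero c (forall_eq_zero_of_constantFrom h)
  obtain ⟨i, hi⟩ := mem_iUnion.1 hcx
  have hxi := hi n le_rfl
  rcases (leafPerm_letter_iff c x n).2 (letter_of_constantFrom h) with h0 | h0
  · rw [h0] at hxi
    subst hxi
    exact eq_replacePrefix hprefix hi
  · have hconst : leafPerm c x = leafPerm c fun _ => 0 := by
      rw [leafPerm_zero]
      funext k
      rcases lt_or_ge k n with hk | hk
      · exact hprefix k hk
      · rw [hi k hk, ← hxi, h0]
    rw [(leafPerm c).injective hconst] at hx
    exact absurd (const_mem_constantFrom n 0) hx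

theorem replacePrefix_mem_binaryWords {c : Fin p} {n : ℕ} {a b : Fin (p + 1)}
    (ha : a = 0 ∨ a = c.succ) (hb : b = 0 ∨ b = c.succ) :
    replacePrefix n a (fun _ => b) ∈ binaryWords c := by
  intro k
  rcases lt_or_ge k n with hk | hk
  · rwa [replacePrefix_of_lt hk]
  · rwa [replacePrefix_of_le hk]

theorem infinitelyManyNonzero_const_succ (c : Fin p) :
    InfinitelyManyNonzero (fun _ => c.succ : ℕ → Fin (p + 1)) :=
  Filter.Frequently.of_forall fun _ => Fin.succ_ne_zero c

theorem not_infinitelyManyNonzero_zero :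
    ¬ InfinitelyManyNonzero (fun _ => 0 : ℕ → Fin (p + 1)) := by
  simp [InfinitelyManyNonzero]

/-- Each word next to `constantFrom p n` is the only one in its direction. -/
theorem outerBoundary_constantFrom [Nonempty (Fin p)] {n : ℕ} {u : ℕ → Fin (p + 1)}
    (hu : u ∈ (starAutomaton p).outerBoundary (constantFrom p n)) :
    (∃ c : Fin p, direction u = (c, true) ∧
      u = leafPerm c (replacePrefix n 0 fun _ => c.succ)) ∨
    ∃ c : Fin p, direction u = (c, false) ∧
      u = (leafPerm c).symm (replacePrefix n c.succ fun _ => 0) := by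
  obtain ⟨huK, s, h⟩ := hu
  have hu0 : u ≠ fun _ => 0 := fun h => huK (h ▸ const_mem_constantFrom n 0)
  rcases s with _ | c
  · simp only [perm_none] at h
    rcases h with h | ⟨x, hx, rfl⟩
    exacts [absurd h huK, absurd hx huK]
  rcases h with h | ⟨x, hx, rfl⟩
  · have heq := leafPerm_enter_constantFrom huK h
    have hbin : u ∈ binaryWords c := by
      rw [← leafPerm_mem_binaryWords_iff, heq]
      exact replacePrefix_mem_binaryWords (Or.inr rfl) (Or.inl rfl)
    refine Or.inr ⟨c, ?_, by rw [← heq, Equiv.symm_apply_apply]⟩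
    rw [direction_eq_iff (hasColour_of_mem_binaryWords hbin hu0),
      ← infinitelyManyNonzero_iff_of_mem_cof (leafPerm_mem_cof c hu0), heq,
      infinitelyManyNonzero_iff_of_mem_cof (replacePrefix_mem_cof _ _ _)]
    exact ⟨rfl, iff_of_false not_infinitelyManyNonzero_zero Bool.false_ne_true⟩
  · change leafPerm c x ∉ _ at huK
    change leafPerm c x ≠ _ at hu0
    have heq := leafPerm_exit_constantFrom hx huK
    have hbin : x ∈ binaryWords c := by
      rw [heq]
      exact replacePrefix_mem_binaryWords (Or.inl rfl) (Or.inr rfl)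
    have hx0 : x ≠ fun _ => 0 := by
      rintro rfl
      exact huK (leafPerm_zero c ▸ const_mem_constantFrom n c.succ)
    refine Or.inl ⟨c, ?_, by rw [← heq]; rfl⟩
    change direction (leafPerm c x) = _
    rw [direction_leafPerm hx0 hu0, direction_eq_iff (hasColour_of_mem_binaryWords hbin hx0), heq,
      infinitelyManyNonzero_iff_of_mem_cof (replacePrefix_mem_cof _ _ _)]
    exact ⟨rfl, iff_of_true (infinitelyManyNonzero_const_succ c) rfl⟩

/-- The Schreier graph of the eventually constant words has `2 * p` ends, the two directions of
each of the `p` lines through `0 ^ ∞`. -/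
theorem encard_end_eq_two_mul (hp : 1 ≤ p) :
    ((starAutomaton p).schreierGraph fun _ => 0).end.encard = (2 * p : ℕ) := by
  have : Nonempty (Fin p) := ⟨⟨0, hp⟩⟩
  have hcard : ENat.card (Fin p × Bool) = (2 * p : ℕ) := by
    rw [ENat.card_eq_coe_fintype_card, Fintype.card_prod, Fintype.card_fin, Fintype.card_bool,
      mul_comm]
  rw [← hcard]
  refine (starAutomaton p).encard_end_schreierGraph _ direction (finite_singleton fun _ => 0)
    ?_ ?_ ?_
  · rintro (_ | c) u - hu hcu
    · rw [perm_none]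
    · exact direction_leafPerm hu hcu
  · rintro ⟨j, b⟩
    rw [orbit_zero]
    cases b
    · refine Set.infinite_of_injective_forall_mem (f := fun m : ℕ => Pi.single m j.succ)
        (fun m n h => ?_) fun m => ?_
      · by_contra hmn
        have := congrFun h m
        simp only [Pi.single_eq_same, Pi.single_eq_of_ne hmn] at this
        exact Fin.succ_ne_zero j this
      · have hcof : Pi.single m j.succ ∈ cof (fun _ => 0 : ℕ → Fin (p + 1)) :=
          ⟨m + 1, fun k hk => by rw [Pi.single_eq_of_ne (show k ≠ m by omega)]⟩
        have hcol : HasColour (Pi.single m j.succ : ℕ → Fin (p + 1)) j := by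
          refine ⟨m, Pi.single_eq_same _ _, fun k _ => ?_⟩
          by_cases hk : k = m
          · exact Or.inr (hk ▸ Pi.single_eq_same _ _)
          · exact Or.inl (Pi.single_eq_of_ne hk _)
        refine ⟨mem_iUnion.2 ⟨0, hcof⟩, (direction_eq_iff hcol _).2 ⟨rfl, ?_⟩⟩
        rw [infinitelyManyNonzero_iff_of_mem_cof hcof]
        exact iff_of_false not_infinitelyManyNonzero_zero Bool.false_ne_true
    · refine Set.infinite_of_injective_forall_mem
        (f := fun m : ℕ => replacePrefix m 0 fun _ => j.succ) (fun m n h => ?_) fun m => ?_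
      · have aux : ∀ m n : ℕ, m < n → replacePrefix m (0 : Fin (p + 1)) (fun _ => j.succ) ≠
            replacePrefix n 0 fun _ => j.succ := by
          intro m n hmn h
          have := congrFun h m
          rw [replacePrefix_of_le le_rfl, replacePrefix_of_lt hmn] at this
          exact Fin.succ_ne_zero j this
        rcases lt_trichotomy m n with hmn | hmn | hmn
        exacts [absurd h (aux m n hmn), hmn, absurd h.symm (aux n m hmn)]
      · have hcof := replacePrefix_mem_cof m 0 (fun _ => j.succ : ℕ → Fin (p + 1))
        have hcol : HasColour (replacePrefix m 0 (fun _ => j.succ : ℕ → Fin (p + 1))) j :=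
          ⟨m, replacePrefix_of_le le_rfl _ _, fun k hk => Or.inr (replacePrefix_of_le hk _ _)⟩
        refine ⟨mem_iUnion.2 ⟨j.succ, hcof⟩, (direction_eq_iff hcol _).2 ⟨rfl, ?_⟩⟩
        rw [infinitelyManyNonzero_iff_of_mem_cof hcof]
        exact iff_of_true (infinitelyManyNonzero_const_succ j) rfl
  · intro F hF hFw
    rw [orbit_zero] at hFw
    have hlarge : ∀ᶠ n in Filter.atTop, ∀ x ∈ F, x ∈ constantFrom p n := by
      refine (Filter.eventually_all_finite hF).2 fun x hx => ?_
      obtain ⟨i, hi⟩ := mem_iUnion.1 (hFw hx)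
      exact (eventually_mem_block hi).mono fun n hn => mem_iUnion.2 ⟨i, hn⟩
    obtain ⟨n, hn⟩ := hlarge.exists
    refine ⟨constantFrom p n, finite_iUnion fun i => finite_block n _, hn, ?_⟩
    intro u hu v hv huv
    have huv' : u = v := by
      rcases outerBoundary_constantFrom hu.2 with ⟨c, hc, hcu⟩ | ⟨c, hc, hcu⟩ <;>
        rcases outerBoundary_constantFrom hv.2 with ⟨d, hd, hdv⟩ | ⟨d, hd, hdv⟩ <;>
        simp only [hc, hd, Prod.mk.injEq, reduceCtorEq, and_false, and_true] at huv
      all_goals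
        subst huv
        rw [hcu, hdv]
    rw [huv']
    exact .refl _

end EventuallyConstant

/-! ### The classification of words by the number of ends -/

section Classification

variable {p : ℕ}

/-- The words that are eventually over `{0, i}` for some leaf `i`. -/
def eventuallyBinaryWords (p : ℕ) : Set (ℕ → Fin (p + 1)) :=
  ⋃ i ∈ {i : Fin (p + 1) | i ≠ 0},
    ⋃ w ∈ {w : ℕ → Fin (p + 1) | ∀ n, w n = 0 ∨ w n = i}, cof w

theorem mem_eventuallyBinaryWords_iff {v : ℕ → Fin (p + 1)} :
    v ∈ eventuallyBinaryWords p ↔ ∃ j : Fin p, ∃ w ∈ binaryWords j, v ∈ cof w := by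
  simp only [eventuallyBinaryWords, mem_iUnion, exists_prop]
  constructor
  · rintro ⟨i, hi, w, hw, hv⟩
    obtain ⟨j, rfl⟩ := Fin.exists_succ_eq.2 hi
    exact ⟨j, w, hw, hv⟩
  · rintro ⟨j, w, hw, hv⟩
    exact ⟨j.succ, Fin.succ_ne_zero j, w, hw, hv⟩

theorem mem_eventuallyBinaryWords_iff_eventually {v : ℕ → Fin (p + 1)} :
    v ∈ eventuallyBinaryWords p ↔
      ∃ j : Fin p, ∀ᶠ n in Filter.atTop, v n = 0 ∨ v n = j.succ := by
  rw [mem_eventuallyBinaryWords_iff]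
  refine exists_congr fun j => ⟨?_, fun h => ?_⟩
  · rintro ⟨w, hw, hv⟩
    exact (mem_cof_iff.1 hv).mono fun n hn => hn ▸ hw n
  · obtain ⟨k, hk⟩ := Filter.eventually_atTop.1 h
    refine ⟨replacePrefix k 0 v, fun n => ?_, mem_cof_symm (replacePrefix_mem_cof k 0 v)⟩
    rcases lt_or_ge n k with hn | hn
    · exact Or.inl (replacePrefix_of_lt hn _ _)
    · rw [replacePrefix_of_le hn]
      exact hk n hn

theorem eventuallyConstantWords_subset (hp : 1 ≤ p) :
    eventuallyConstantWords (Fin (p + 1)) ⊆ eventuallyBinaryWords p := by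
  intro v hv
  obtain ⟨i, hi⟩ := mem_iUnion.1 hv
  rw [mem_eventuallyBinaryWords_iff]
  rcases Fin.eq_zero_or_eq_succ i with rfl | ⟨j, rfl⟩
  · exact ⟨⟨0, hp⟩, _, fun _ => Or.inl rfl, hi⟩
  · exact ⟨j, _, fun _ => Or.inr rfl, hi⟩

theorem encard_end_of_eventuallyConstant (hp : 1 ≤ p) {v : ℕ → Fin (p + 1)}
    (hv : v ∈ eventuallyConstantWords (Fin (p + 1))) : v ∈ endedWords p (2 * p) := by
  rw [← orbit_zero] at hv
  exact (encard_end_eq_of_mem_orbit hv).trans (encard_end_eq_two_mul hp)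

theorem encard_end_of_eventuallyBinary {v : ℕ → Fin (p + 1)}
    (hv : v ∈ eventuallyBinaryWords p \ eventuallyConstantWords (Fin (p + 1))) :
    v ∈ endedWords p 2 := by
  obtain ⟨j, w, hw, hvw⟩ := mem_eventuallyBinaryWords_iff.1 hv.1
  refine (encard_end_eq_of_mem_orbit (cof_subset_orbit w hvw)).trans (encard_end_eq_two ?_ hw)
  rw [← mem_eventuallyConstantWords_of_mem_cof hvw]
  exact hv.2

theorem encard_end_of_not_eventuallyBinary (hp : 1 ≤ p) {v : ℕ → Fin (p + 1)}
    (hv : v ∉ eventuallyBinaryWords p) : v ∈ endedWords p 1 := by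
  refine (encard_end_eq_one (fun h => hv (eventuallyConstantWords_subset hp h)) fun j h => hv ?_)
  exact mem_eventuallyBinaryWords_iff_eventually.2 ⟨j, h.mono fun n hn => not_not.1 hn⟩

theorem mem_endedWords_trichotomy (hp : 1 ≤ p) (v : ℕ → Fin (p + 1)) :
    (v ∈ eventuallyConstantWords (Fin (p + 1)) ∧ v ∈ endedWords p (2 * p)) ∨
    (v ∈ eventuallyBinaryWords p \ eventuallyConstantWords (Fin (p + 1)) ∧ v ∈ endedWords p 2) ∨
    (v ∉ eventuallyBinaryWords p ∧ v ∈ endedWords p 1) := by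
  by_cases h1 : v ∈ eventuallyConstantWords (Fin (p + 1))
  · exact Or.inl ⟨h1, encard_end_of_eventuallyConstant hp h1⟩
  · by_cases h2 : v ∈ eventuallyBinaryWords p
    · exact Or.inr (Or.inl ⟨⟨h2, h1⟩, encard_end_of_eventuallyBinary ⟨h2, h1⟩⟩)
    · exact Or.inr (Or.inr ⟨h2, encard_end_of_not_eventuallyBinary hp h2⟩)

theorem eq_of_mem_endedWords {v : ℕ → Fin (p + 1)} {k l : ℕ} (hk : v ∈ endedWords p k)
    (hl : v ∈ endedWords p l) : k = l := by
  have h : (k : ℕ∞) = l := Eq.trans (Eq.symm hk) hl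
  exact_mod_cast h

theorem endedWords_two_mul (hp : 2 ≤ p) :
    endedWords p (2 * p) = eventuallyConstantWords (Fin (p + 1)) := by
  ext v
  rcases mem_endedWords_trichotomy (by omega) v with ⟨h, h'⟩ | ⟨h, h'⟩ | ⟨h, h'⟩
  · exact iff_of_true h' h
  · refine iff_of_false (fun hv => ?_) h.2
    have := eq_of_mem_endedWords hv h'
    omega
  · refine iff_of_false (fun hv => ?_) fun hv => h (eventuallyConstantWords_subset (by omega) hv)
    have := eq_of_mem_endedWords hv h'
    omega

theorem endedWords_two (hp : 2 ≤ p) :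
    endedWords p 2 = eventuallyBinaryWords p \ eventuallyConstantWords (Fin (p + 1)) := by
  ext v
  rcases mem_endedWords_trichotomy (by omega) v with ⟨h, h'⟩ | ⟨h, h'⟩ | ⟨h, h'⟩
  · refine iff_of_false (fun hv => ?_) fun hv => hv.2 h
    have := eq_of_mem_endedWords hv h'
    omega
  · exact iff_of_true h' h
  · refine iff_of_false (fun hv => ?_) fun hv => h hv.1
    have := eq_of_mem_endedWords hv h'
    omega

theorem endedWords_one (hp : 2 ≤ p) : endedWords p 1 = (eventuallyBinaryWords p)ᶜ := by
  ext v
  rcases mem_endedWords_trichotomy (by omega) v with ⟨h, h'⟩ | ⟨h, h'⟩ | ⟨h, h'⟩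
  · refine iff_of_false (fun hv => ?_) fun hv => hv (eventuallyConstantWords_subset (by omega) h)
    have := eq_of_mem_endedWords hv h'
    omega
  · refine iff_of_false (fun hv => ?_) fun hv => hv h.1
    have := eq_of_mem_endedWords hv h'
    omega
  · exact iff_of_true h' h

end Classification

/-! ### Uncountably many orbits -/

section Uncountable

variable {p : ℕ}

/-- The word over `{a, c}` whose block of the letters `2 n` and `2 n + 1` is `a c` or `c a`,
according to the value of `b` at `n`. -/
def pairWord {X : Type*} (a c : X) (b : ℕ → Bool) : ℕ → X :=
  fun n => if b (n / 2) = decide (n % 2 = 0) then a else c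

theorem pairWord_injective {X : Type*} {a c : X} (hac : a ≠ c) :
    Function.Injective (pairWord a c) := by
  intro b b' h
  funext n
  have := congrFun h (2 * n)
  simp only [pairWord, Nat.mul_div_cancel_left n two_pos, Nat.mul_mod_right, decide_true] at this
  rcases Bool.eq_false_or_eq_true (b n) with h1 | h1 <;>
    rcases Bool.eq_false_or_eq_true (b' n) with h2 | h2 <;> simp_all [hac.symm]

theorem frequently_pairWord_eq {X : Type*} (a c : X) (b : ℕ → Bool) :
    (∃ᶠ n in Filter.atTop, pairWord a c b n = a) ∧ ∃ᶠ n in Filter.atTop, pairWord a c b n = c := by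
  have h0 : ∀ n, pairWord a c b (2 * n) = if b n = true then a else c := fun n => by
    simp [pairWord]
  have h1 : ∀ n, pairWord a c b (2 * n + 1) = if b n = true then c else a := fun n => by
    have : (2 * n + 1) / 2 = n := by omega
    rcases Bool.eq_false_or_eq_true (b n) with h | h <;> simp [pairWord, this, h, Nat.add_mod]
  constructor <;> refine Filter.frequently_atTop.2 fun n => ?_
  · by_cases h : b n = true
    · exact ⟨2 * n, by omega, by rw [h0, if_pos h]⟩
    · exact ⟨2 * n + 1, by omega, by rw [h1, if_neg h]⟩
  · by_cases h : b n = true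
    · exact ⟨2 * n + 1, by omega, by rw [h1, if_pos h]⟩
    · exact ⟨2 * n, by omega, by rw [h0, if_neg h]⟩

theorem not_countable_of_pairWord_mem {X : Type*} {a c : X} (hac : a ≠ c) {O : Set (ℕ → X)}
    (h : ∀ b, pairWord a c b ∈ O) : ¬ O.Countable := by
  intro hO
  have huniv : (univ : Set (ℕ → Bool)).Countable :=
    (mapsTo_univ_iff.2 h).countable_of_injOn (pairWord_injective hac).injOn hO
  rw [countable_univ_iff] at huniv
  obtain ⟨f, hf⟩ := exists_surjective_nat (ℕ → Bool)
  obtain ⟨n, hn⟩ := hf fun n => !f n n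
  simpa using congrFun hn n

/-- As orbits are countable, an invariant set consists of uncountably many orbits as soon as it is
uncountable. -/
theorem consistsOfUncountablyManyOrbits {O : Set (ℕ → Fin (p + 1))} (hO : ¬ O.Countable)
    (hinv : ∀ w ∈ O, (starAutomaton p).orbit w ⊆ O) :
    (starAutomaton p).ConsistsOfUncountablyManyOrbits O := by
  have heq : O = ⋃₀ ((starAutomaton p).orbit '' O) := by
    refine Subset.antisymm (fun w hw => ?_) (sUnion_subset ?_)
    · exact ⟨_, ⟨w, hw, rfl⟩, (starAutomaton p).mem_orbit_self w⟩
    · rintro _ ⟨w, hw, rfl⟩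
      exact hinv w hw
  refine ⟨(starAutomaton p).orbit '' O, ?_, fun hcount => hO ?_, heq⟩
  · rintro _ ⟨w, -, rfl⟩
    exact ⟨w, rfl⟩
  · rw [heq]
    refine hcount.sUnion ?_
    rintro _ ⟨w, -, rfl⟩
    exact countable_orbit w

theorem orbit_subset_endedWords {k : ℕ} {w : ℕ → Fin (p + 1)} (hw : w ∈ endedWords p k) :
    (starAutomaton p).orbit w ⊆ endedWords p k :=
  fun _ hu => (encard_end_eq_of_mem_orbit hu).trans hw

theorem pairWord_notMem_eventuallyConstantWords {X : Type*} {a c : X} (hac : a ≠ c)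
    (b : ℕ → Bool) : pairWord a c b ∉ eventuallyConstantWords X := by
  intro h
  obtain ⟨i, hi⟩ := mem_iUnion.1 h
  obtain ⟨ha, hc⟩ := frequently_pairWord_eq a c b
  obtain ⟨m, hm, hm'⟩ := (ha.and_eventually (mem_cof_iff.1 hi)).exists
  obtain ⟨n, hn, hn'⟩ := (hc.and_eventually (mem_cof_iff.1 hi)).exists
  exact hac ((hm.symm.trans hm'.symm).trans (hn'.trans hn))

theorem not_countable_endedWords_two (hp : 2 ≤ p) : ¬ (endedWords p 2).Countable := by
  let j : Fin p := ⟨0, by omega⟩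
  refine not_countable_of_pairWord_mem (Fin.succ_ne_zero j).symm fun b => ?_
  rw [endedWords_two hp]
  refine ⟨mem_eventuallyBinaryWords_iff.2 ⟨j, _, fun n => ?_, mem_cof_self _⟩,
    pairWord_notMem_eventuallyConstantWords (Fin.succ_ne_zero j).symm b⟩
  unfold pairWord
  split_ifs
  exacts [Or.inl rfl, Or.inr rfl]

theorem not_countable_endedWords_one (hp : 2 ≤ p) : ¬ (endedWords p 1).Countable := by
  let i : Fin p := ⟨0, by omega⟩
  let j : Fin p := ⟨1, by omega⟩
  have hij : i.succ ≠ j.succ := fun h => absurd (Fin.succ_injective _ h) (by simp [i, j])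
  refine not_countable_of_pairWord_mem hij fun b => ?_
  rw [endedWords_one hp, mem_compl_iff, mem_eventuallyBinaryWords_iff_eventually]
  rintro ⟨k, hk⟩
  obtain ⟨hi, hj⟩ := frequently_pairWord_eq i.succ j.succ b
  have aux : ∀ {l : Fin p}, (∃ᶠ n in Filter.atTop, pairWord i.succ j.succ b n = l.succ) →
      l.succ = k.succ := by
    intro l hl
    obtain ⟨n, hn, hn'⟩ := (hl.and_eventually hk).exists
    rw [hn] at hn'
    exact hn'.resolve_left (Fin.succ_ne_zero l)
  exact hij ((aux hi).trans (aux hj).symm)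

end Uncountable

/-! ### The measure of the words with one end -/

section Measure

variable {p : ℕ}

theorem measurableSet_forall_letter (T : Set (Fin (p + 1))) (k : ℕ) :
    MeasurableSet {x : ℕ → Fin (p + 1) | ∀ n, k ≤ n → x n ∈ T} := by
  have h : {x : ℕ → Fin (p + 1) | ∀ n, k ≤ n → x n ∈ T} = ⋂ n, ⋂ (_ : k ≤ n), {x | x n ∈ T} := by
    ext x
    simp
  rw [h]
  exact MeasurableSet.iInter fun n => MeasurableSet.iInter fun _ =>
    measurable_pi_apply n (MeasurableSet.of_discrete (s := T))

theorem eventuallyBinaryWords_eq_iUnion : eventuallyBinaryWords p =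
    ⋃ j : Fin p, ⋃ k : ℕ, {x | ∀ n, k ≤ n → x n ∈ ({0, j.succ} : Set (Fin (p + 1)))} := by
  ext x
  simp [mem_eventuallyBinaryWords_iff_eventually, Filter.eventually_atTop]

theorem measurableSet_eventuallyBinaryWords : MeasurableSet (eventuallyBinaryWords p) := by
  rw [eventuallyBinaryWords_eq_iUnion]
  exact MeasurableSet.iUnion fun j => MeasurableSet.iUnion fun k => measurableSet_forall_letter _ k

instance : IsProbabilityMeasure (uniformWordMeasure p) := by
  unfold uniformWordMeasure
  infer_instance

/-- Almost no word avoids, from some position on, a letter outside a proper subset `T`. -/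
theorem uniformWordMeasure_forall_letter {T : Set (Fin (p + 1))} (hT : T ≠ univ) (k : ℕ) :
    uniformWordMeasure p {x | ∀ n, k ≤ n → x n ∈ T} = 0 := by
  classical
  set r := (PMF.uniformOfFintype (Fin (p + 1))).toMeasure T with hr
  have hr1 : r < 1 := by
    rw [hr, PMF.toMeasure_uniformOfFintype_apply _ MeasurableSet.of_discrete,
      ENNReal.div_lt_iff (by simp) (by simp), one_mul]
    have : Fintype.card T < Fintype.card (Fin (p + 1)) := by
      obtain ⟨x, hx⟩ := (ne_univ_iff_exists_notMem T).1 hT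
      exact Fintype.card_subtype_lt (p := (· ∈ T)) hx
    exact_mod_cast this
  have hle : ∀ N : ℕ, uniformWordMeasure p {x | ∀ n, k ≤ n → x n ∈ T} ≤ r ^ N := by
    intro N
    calc uniformWordMeasure p {x | ∀ n, k ≤ n → x n ∈ T}
        ≤ uniformWordMeasure p (Set.pi (Finset.Ico k (k + N)) fun _ => T) :=
          measure_mono fun x hx n hn => hx n (Finset.mem_Ico.1 hn).1
      _ = r ^ N := by
          rw [uniformWordMeasure, Measure.infinitePi_pi _ fun _ _ => MeasurableSet.of_discrete,
            Finset.prod_const, Nat.card_Ico, Nat.add_sub_cancel_left]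
  have hlim := ENNReal.tendsto_pow_atTop_nhds_zero_of_lt_one hr1
  exact le_antisymm (ge_of_tendsto' hlim hle) zero_le

theorem uniformWordMeasure_eventuallyBinaryWords (hp : 2 ≤ p) :
    uniformWordMeasure p (eventuallyBinaryWords p) = 0 := by
  rw [eventuallyBinaryWords_eq_iUnion, measure_iUnion_null_iff]
  intro j
  rw [measure_iUnion_null_iff]
  intro k
  refine uniformWordMeasure_forall_letter (fun h => ?_) k
  have h1 : (univ : Set (Fin (p + 1))).ncard ≤ 2 := by
    rw [← h]
    exact (ncard_insert_le _ _).trans_eq (by rw [ncard_singleton])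
  rw [ncard_univ, Nat.card_eq_fintype_card, Fintype.card_fin] at h1
  omega

end Measure

theorem theorem4p12 (p : ℕ) (hp : 1 ≤ p) :
    (∀ v : ℕ → Fin (p + 1),
      v ∈ endedWords p (2 * p) ∨ v ∈ endedWords p 2 ∨ v ∈ endedWords p 1) ∧
    (2 ≤ p →
      (endedWords p (2 * p) = ⋃ i : Fin (p + 1), cof (fun _ : ℕ => i) ∧
        ∃ w, endedWords p (2 * p) = (starAutomaton p).orbit w) ∧
      (endedWords p 2 =
          (⋃ i ∈ {i : Fin (p + 1) | i ≠ 0},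
            ⋃ w ∈ {w : ℕ → Fin (p + 1) | ∀ n, w n = 0 ∨ w n = i}, cof w) \
            endedWords p (2 * p) ∧
        (starAutomaton p).ConsistsOfUncountablyManyOrbits (endedWords p 2)) ∧
      (endedWords p 1 = (endedWords p (2 * p) ∪ endedWords p 2)ᶜ ∧
        (starAutomaton p).ConsistsOfUncountablyManyOrbits (endedWords p 1)) ∧
      (MeasurableSet (endedWords p 1) ∧ uniformWordMeasure p (endedWords p 1) = 1)) := by
  refine ⟨fun v => ?_, fun hp2 => ⟨⟨endedWords_two_mul hp2, fun _ => 0, ?_⟩, ⟨?_, ?_⟩, ⟨?_, ?_⟩,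
    ?_, ?_⟩⟩
  · exact (mem_endedWords_trichotomy hp v).imp And.right (Or.imp And.right And.right)
  · rw [orbit_zero, endedWords_two_mul hp2]
  · rw [endedWords_two_mul hp2]
    exact endedWords_two hp2
  · exact consistsOfUncountablyManyOrbits (not_countable_endedWords_two hp2)
      fun _ => orbit_subset_endedWords
  · rw [endedWords_one hp2, endedWords_two_mul hp2, endedWords_two hp2, union_sdiff_self,
      union_eq_self_of_subset_left (eventuallyConstantWords_subset hp)]
  · exact consistsOfUncountablyManyOrbits (not_countable_endedWords_one hp2)
      fun _ => orbit_subset_endedWords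
  · rw [endedWords_one hp2]
    exact measurableSet_eventuallyBinaryWords.compl
  · rw [endedWords_one hp2, prob_compl_eq_one_iff measurableSet_eventuallyBinaryWords]
    exact uniformWordMeasure_eventuallyBinaryWords hp2
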